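/- A \emph{shrub} on a finite non-empty set $I$ is a simple graph on $I$ together with a height function $h:I\to\mathbb N$ such that: (1) if $i-j$ is an edge then $h(i)=h(j)\pm1$; (2) if $h(j)>0$ there is an edge $i-j$ with $h(i)=h(j)-1$; (3) for no $k$ does the graph contain, as an induced subgraph, either of the following two configurations: vertices $a,b$ of height $k+1$ and $c,d,e$ of height $k$ with exactly the edges $a-c,\ a-d,\ b-d,\ b-e$; or vertices $a$ of height $k+2$, $b,c$ of height $k+1$ and $d$ of height $k$ with exactly the edges $a-b,\ a-c,\ b-d$. For a shrub $P$ on $I$, $i\in I$, and a shrub $Q$ on $J$, the composition $P\circ_i Q$ is the shrub on $(I\setminus\{i\})\sqcup J$ obtained from the disjoint union of $P\setminus\{i\}$ and $Q$ by joining every neighbour of $i$ in $P$ to every vertex of height $0$ of $Q$; heights are unchanged on $I\setminus\{i\}$ and increased by $h_P(i)$ on $J$. With relabelling along bijections and the one-vertex shrub as unit, this defines a symmetric set operad $\operatorname{Arb}$ (with no element on the empty set). Let $[1][2]$ be the graph with two vertices $1,2$ of height $0$ and no edge, and $[1\triangleleft 2]$ the rooted tree on $\{1,2\}$ with root $1$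 (an edge $1-2$ with $h(1)=0$, $h(2)=1$). \textbf{Theorem.} The set operad $\operatorname{Arb}$ is generated by its two elements $[1][2]$ and $[1\triangleleft 2]$ of degree $2$, subject only to the relations $$[*\triangleleft 1]\circ_*[3\triangleleft 2]=[*\triangleleft 2]\circ_*[3\triangleleft 1]=[3\triangleleft *]\circ_*[1][2]$$ and $$[*][1]\circ_*[2][3]=[*][2]\circ_*[3][1].$$ That is: every suboperad of $\operatorname{Arb}$ that contains $[1][2]$ and $[1\triangleleft2]$ is $\operatorname{Arb}$; the relations hold in $\operatorname{Arb}$; and if $\mathtt A$ is the quotient of the free symmetric set operad on generators $C_{1,2}=C_{2,1}$ and $D_{1,2}$ of degree $2$ by the operadic congruence generated by the relations obtained by replacing $[a][b]$ by $C_{a,b}$ and $[a\triangleleft b]$ by $D_{a,b}$, then there is a unique operad morphism $\mathtt A\to\operatorname{Arb}$ with $C_{1,2}\mapsto[1][2]$ and $D_{1,2}\mapsto[1\triangleleft2]$, and it is an isomorphism. In particular $\operatorname{Arb}$ is binary quadratic: it has a presentation with generators of degree $2$ and relations of degree $3$. -/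

import Mathlib

universe u v

/-! ## Bijections between the index sets occurring in the operad axioms -/

/-- A pair of bijections `e : I ≃ I'`, `f : J ≃ J'` induces a bijection
`(I ∖ {i}) ⊔ J ≃ (I' ∖ {e i}) ⊔ J'`. -/
def compCongr {I I' J J' : Type} (e : I ≃ I') (f : J ≃ J') (i : I) :
    ({x : I // x ≠ i} ⊕ J) ≃ ({x : I' // x ≠ e i} ⊕ J') :=
  Equiv.sumCongr (e.subtypeEquiv fun a => by simp) f

/-- `({*} ∖ {*}) ⊔ J ≃ J`. -/
def unitLeft (J : Type) : ({x : Unit // x ≠ ()} ⊕ J) ≃ J where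
  toFun := Sum.elim (fun x => (x.2 rfl).elim) id
  invFun := Sum.inr
  left_inv := by rintro (⟨x, h⟩ | y) <;> [exact (h rfl).elim; rfl]
  right_inv _ := rfl

open Classical in
/-- `(I ∖ {i}) ⊔ {*} ≃ I`, where `*` goes to `i`. -/
noncomputable def unitRight {I : Type} (i : I) : ({x : I // x ≠ i} ⊕ Unit) ≃ I where
  toFun := Sum.elim (fun x => x.1) (fun _ => i)
  invFun x := if h : x = i then Sum.inr () else Sum.inl ⟨x, h⟩
  left_inv := by rintro (⟨x, h⟩ | ⟨⟩) <;> simp_all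
  right_inv x := by by_cases h : x = i <;> simp [h]

/-- `(((I ∖ {i}) ⊔ J) ∖ {j}) ⊔ K ≃ (((I ∖ {j}) ⊔ K) ∖ {i}) ⊔ J` for distinct `i, j` in `I`;
every label goes to itself. -/
def parallelEquiv {I J K : Type} {i j : I} (hij : i ≠ j) :
    ({x : {y : I // y ≠ i} ⊕ J // x ≠ Sum.inl ⟨j, hij.symm⟩} ⊕ K) ≃
      ({x : {y : I // y ≠ j} ⊕ K // x ≠ Sum.inl ⟨i, hij⟩} ⊕ J) where
  toFun
    | Sum.inl ⟨Sum.inl ⟨y, hy⟩, h⟩ =>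
        Sum.inl ⟨Sum.inl ⟨y, fun e => h (by subst e; rfl)⟩, fun e => hy (by simpa using e)⟩
    | Sum.inl ⟨Sum.inr y, _⟩ => Sum.inr y
    | Sum.inr z => Sum.inl ⟨Sum.inr z, by simp⟩
  invFun
    | Sum.inl ⟨Sum.inl ⟨y, hy⟩, h⟩ =>
        Sum.inl ⟨Sum.inl ⟨y, fun e => h (by subst e; rfl)⟩, fun e => hy (by simpa using e)⟩
    | Sum.inl ⟨Sum.inr z, _⟩ => Sum.inr z
    | Sum.inr y => Sum.inl ⟨Sum.inr y, by simp⟩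
  left_inv := by rintro (⟨⟨y, hy⟩ | y, h⟩ | z) <;> rfl
  right_inv := by rintro (⟨⟨y, hy⟩ | y, h⟩ | z) <;> rfl

/-- `(((I ∖ {i}) ⊔ J) ∖ {j}) ⊔ K ≃ (I ∖ {i}) ⊔ ((J ∖ {j}) ⊔ K)` for `i` in `I` and `j` in `J`;
every label goes to itself. -/
def nestedEquiv {I J K : Type} (i : I) (j : J) :
    ({x : {y : I // y ≠ i} ⊕ J // x ≠ Sum.inr j} ⊕ K) ≃
      ({y : I // y ≠ i} ⊕ ({x : J // x ≠ j} ⊕ K)) where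
  toFun
    | Sum.inl ⟨Sum.inl y, _⟩ => Sum.inl y
    | Sum.inl ⟨Sum.inr x, h⟩ => Sum.inr (Sum.inl ⟨x, fun e => h (by rw [e])⟩)
    | Sum.inr z => Sum.inr (Sum.inr z)
  invFun
    | Sum.inl y => Sum.inl ⟨Sum.inl y, by simp⟩
    | Sum.inr (Sum.inl ⟨x, h⟩) => Sum.inl ⟨Sum.inr x, fun e => h (by simpa using e)⟩
    | Sum.inr (Sum.inr z) => Sum.inr z
  left_inv := by rintro (⟨y | x, h⟩ | z) <;> rfl
  right_inv := by rintro (y | ⟨x, h⟩ | z) <;> rfl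

/-! ## Set operads -/

/-- A species of sets: a functor from finite sets and bijections to sets. -/
structure Species where
  obj : (I : Type) → [Finite I] → Type u
  map : {I J : Type} → [Finite I] → [Finite J] → (I ≃ J) → obj I → obj J
  map_refl : ∀ {I : Type} [Finite I] (x : obj I), map (Equiv.refl I) x = x
  map_trans : ∀ {I J K : Type} [Finite I] [Finite J] [Finite K] (e : I ≃ J) (f : J ≃ K)
    (x : obj I), map (e.trans f) x = map f (map e x)

/-- A (symmetric) set operad: a species of sets with a unit and partial compositions
`p ∘_i q`, for `p` on `I`, `i ∈ I` and `q` on `J`, with value on `(I ∖ {i}) ⊔ J`. -/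
structure SetOperad extends Species.{u} where
  one : obj Unit
  comp : {I J : Type} → [Finite I] → [Finite J] → (i : I) → obj I → obj J →
    obj ({x : I // x ≠ i} ⊕ J)
  comp_map : ∀ {I I' J J' : Type} [Finite I] [Finite I'] [Finite J] [Finite J']
    (e : I ≃ I') (f : J ≃ J') (i : I) (p : obj I) (q : obj J),
    comp (e i) (map e p) (map f q) = map (compCongr e f i) (comp i p q)
  one_comp : ∀ {J : Type} [Finite J] (q : obj J), map (unitLeft J) (comp () one q) = q
  comp_one : ∀ {I : Type} [Finite I] (i : I) (p : obj I), map (unitRight i) (comp i p one) = p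
  comp_parallel : ∀ {I J K : Type} [Finite I] [Finite J] [Finite K] {i j : I} (hij : i ≠ j)
    (p : obj I) (q : obj J) (r : obj K),
    map (parallelEquiv hij) (comp (Sum.inl ⟨j, hij.symm⟩) (comp i p q) r) =
      comp (Sum.inl ⟨i, hij⟩) (comp j p r) q
  comp_nested : ∀ {I J K : Type} [Finite I] [Finite J] [Finite K] (i : I) (j : J)
    (p : obj I) (q : obj J) (r : obj K),
    map (nestedEquiv i j) (comp (Sum.inr j) (comp i p q) r) = comp i p (comp j q r)

/-- Morphisms of set operads. -/
@[ext]
structure SetOperad.Hom (O : SetOperad.{u}) (O' : SetOperad.{v}) where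
  app : (I : Type) → [Finite I] → O.obj I → O'.obj I
  app_map : ∀ {I J : Type} [Finite I] [Finite J] (e : I ≃ J) (x : O.obj I),
    app J (O.map e x) = O'.map e (app I x)
  app_one : app Unit O.one = O'.one
  app_comp : ∀ {I J : Type} [Finite I] [Finite J] (i : I) (p : O.obj I) (q : O.obj J),
    app ({x : I // x ≠ i} ⊕ J) (O.comp i p q) = O'.comp i (app I p) (app J q)

/-- A morphism of set operads is an isomorphism when all its components are bijections. -/
def SetOperad.Hom.IsIso {O : SetOperad.{u}} {O' : SetOperad.{v}} (φ : O.Hom O') : Prop :=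
  ∀ (I : Type) [Finite I], Function.Bijective (φ.app I)

/-- A family of subsets of a set operad which is a suboperad. -/
structure SetOperad.IsSuboperad (O : SetOperad.{u})
    (S : (I : Type) → [Finite I] → Set (O.obj I)) : Prop where
  one_mem : O.one ∈ S Unit
  map_mem : ∀ {I J : Type} [Finite I] [Finite J] (e : I ≃ J) (x : O.obj I),
    x ∈ S I → O.map e x ∈ S J
  comp_mem : ∀ {I J : Type} [Finite I] [Finite J] (i : I) (p : O.obj I) (q : O.obj J),
    p ∈ S I → q ∈ S J → O.comp i p q ∈ S ({x : I // x ≠ i} ⊕ J)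

/-! ## Free operads and quotient operads -/

/-- Formal operadic expressions in the elements of a species `E`. -/
inductive FreeTerm (E : Species.{u}) : Type → Type (max 1 u)
  | one : FreeTerm E Unit
  | gen {I : Type} [Finite I] (x : E.obj I) : FreeTerm E I
  | map {I J : Type} (e : I ≃ J) (t : FreeTerm E I) : FreeTerm E J
  | comp {I J : Type} (i : I) (s : FreeTerm E I) (t : FreeTerm E J) :
      FreeTerm E ({x : I // x ≠ i} ⊕ J)

/-- The equality of formal expressions which is forced by the axioms of operads and by the
action of bijections on `E`: the smallest congruence that contains these axioms. -/
inductive FreeRel (E : Species.{u}) : {I : Type} → FreeTerm E I → FreeTerm E I → Prop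
  | refl {I : Type} (s : FreeTerm E I) : FreeRel E s s
  | symm {I : Type} {s t : FreeTerm E I} : FreeRel E s t → FreeRel E t s
  | trans {I : Type} {s t r : FreeTerm E I} : FreeRel E s t → FreeRel E t r → FreeRel E s r
  | map_congr {I J : Type} (e : I ≃ J) {s t : FreeTerm E I} :
      FreeRel E s t → FreeRel E (.map e s) (.map e t)
  | comp_congr {I J : Type} (i : I) {s s' : FreeTerm E I} {t t' : FreeTerm E J} :
      FreeRel E s s' → FreeRel E t t' → FreeRel E (.comp i s t) (.comp i s' t')
  | gen_map {I J : Type} [Finite I] [Finite J] (e : I ≃ J) (x : E.obj I) :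
      FreeRel E (.gen (E.map e x)) (.map e (.gen x))
  | map_refl {I : Type} (s : FreeTerm E I) : FreeRel E (.map (Equiv.refl I) s) s
  | map_trans {I J K : Type} (e : I ≃ J) (f : J ≃ K) (s : FreeTerm E I) :
      FreeRel E (.map (e.trans f) s) (.map f (.map e s))
  | comp_map {I I' J J' : Type} (e : I ≃ I') (f : J ≃ J') (i : I) (s : FreeTerm E I)
      (t : FreeTerm E J) :
      FreeRel E (.comp (e i) (.map e s) (.map f t)) (.map (compCongr e f i) (.comp i s t))
  | one_comp {J : Type} (t : FreeTerm E J) :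
      FreeRel E (.map (unitLeft J) (.comp () .one t)) t
  | comp_one {I : Type} (i : I) (s : FreeTerm E I) :
      FreeRel E (.map (unitRight i) (.comp i s .one)) s
  | comp_parallel {I J K : Type} {i j : I} (hij : i ≠ j) (p : FreeTerm E I) (q : FreeTerm E J)
      (r : FreeTerm E K) :
      FreeRel E (.map (parallelEquiv hij) (.comp (Sum.inl ⟨j, hij.symm⟩) (.comp i p q) r))
        (.comp (Sum.inl ⟨i, hij⟩) (.comp j p r) q)
  | comp_nested {I J K : Type} (i : I) (j : J) (p : FreeTerm E I) (q : FreeTerm E J)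
      (r : FreeTerm E K) :
      FreeRel E (.map (nestedEquiv i j) (.comp (Sum.inr j) (.comp i p q) r))
        (.comp i p (.comp j q r))

/-- Equality of formal expressions as an equivalence relation. -/
def freeSetoid (E : Species.{u}) (I : Type) : Setoid (FreeTerm E I) where
  r := FreeRel E
  iseqv := ⟨FreeRel.refl, FreeRel.symm, FreeRel.trans⟩

/-- The free set operad on a species `E`. -/
def FreeOperad (E : Species.{u}) : SetOperad.{max 1 u} where
  obj I _ := Quotient (freeSetoid E I)
  map e := Quotient.map (FreeTerm.map e) fun _ _ h => FreeRel.map_congr e h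
  map_refl := by rintro I _ ⟨s⟩; exact Quotient.sound (FreeRel.map_refl s)
  map_trans := by rintro I J K _ _ _ e f ⟨s⟩; exact Quotient.sound (FreeRel.map_trans e f s)
  one := Quotient.mk _ FreeTerm.one
  comp i := Quotient.map₂ (FreeTerm.comp i) fun _ _ h _ _ h' => FreeRel.comp_congr i h h'
  comp_map := by
    rintro I I' J J' _ _ _ _ e f i ⟨s⟩ ⟨t⟩; exact Quotient.sound (FreeRel.comp_map e f i s t)
  one_comp := by rintro J _ ⟨t⟩; exact Quotient.sound (FreeRel.one_comp t)
  comp_one := by rintro I _ i ⟨s⟩; exact Quotient.sound (FreeRel.comp_one i s)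
  comp_parallel := by
    rintro I J K _ _ _ i j hij ⟨p⟩ ⟨q⟩ ⟨r⟩
    exact Quotient.sound (FreeRel.comp_parallel hij p q r)
  comp_nested := by
    rintro I J K _ _ _ i j ⟨p⟩ ⟨q⟩ ⟨r⟩
    exact Quotient.sound (FreeRel.comp_nested i j p q r)

/-- The generator of the free operad given by an element of `E`. -/
def FreeOperad.gen {E : Species.{u}} {I : Type} [Finite I] (x : E.obj I) :
    (FreeOperad E).obj I :=
  Quotient.mk (freeSetoid E I) (FreeTerm.gen x)

/-- The operadic congruence (the "ideal") generated by a family `R` of relations. -/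
inductive SetOperad.Cong (O : SetOperad.{u})
    (R : (I : Type) → [Finite I] → O.obj I → O.obj I → Prop) :
    (I : Type) → [Finite I] → O.obj I → O.obj I → Prop
  | of {I : Type} [Finite I] {x y : O.obj I} : R I x y → O.Cong R I x y
  | refl {I : Type} [Finite I] (x : O.obj I) : O.Cong R I x x
  | symm {I : Type} [Finite I] {x y : O.obj I} : O.Cong R I x y → O.Cong R I y x
  | trans {I : Type} [Finite I] {x y z : O.obj I} :
      O.Cong R I x y → O.Cong R I y z → O.Cong R I x z
  | map {I J : Type} [Finite I] [Finite J] (e : I ≃ J) {x y : O.obj I} :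
      O.Cong R I x y → O.Cong R J (O.map e x) (O.map e y)
  | comp {I J : Type} [Finite I] [Finite J] (i : I) {x x' : O.obj I} {y y' : O.obj J} :
      O.Cong R I x x' → O.Cong R J y y' →
        O.Cong R ({x : I // x ≠ i} ⊕ J) (O.comp i x y) (O.comp i x' y')

/-- The generated congruence as an equivalence relation. -/
def SetOperad.congSetoid (O : SetOperad.{u})
    (R : (I : Type) → [Finite I] → O.obj I → O.obj I → Prop) (I : Type) [Finite I] :
    Setoid (O.obj I) where
  r := O.Cong R I
  iseqv := ⟨SetOperad.Cong.refl, SetOperad.Cong.symm, SetOperad.Cong.trans⟩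

/-- The quotient of a set operad by the congruence generated by a family of relations. -/
def SetOperad.quotient (O : SetOperad.{u})
    (R : (I : Type) → [Finite I] → O.obj I → O.obj I → Prop) : SetOperad.{u} where
  obj I _ := Quotient (O.congSetoid R I)
  map e := Quotient.map (O.map e) fun _ _ h => SetOperad.Cong.map e h
  map_refl := by rintro I _ ⟨x⟩; exact congrArg (Quotient.mk _) (O.map_refl x)
  map_trans := by
    rintro I J K _ _ _ e f ⟨x⟩; exact congrArg (Quotient.mk _) (O.map_trans e f x)
  one := Quotient.mk _ O.one
  comp i := Quotient.map₂ (O.comp i) fun _ _ h _ _ h' => SetOperad.Cong.comp i h h'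
  comp_map := by
    rintro I I' J J' _ _ _ _ e f i ⟨p⟩ ⟨q⟩
    exact congrArg (Quotient.mk _) (O.comp_map e f i p q)
  one_comp := by rintro J _ ⟨q⟩; exact congrArg (Quotient.mk _) (O.one_comp q)
  comp_one := by rintro I _ i ⟨p⟩; exact congrArg (Quotient.mk _) (O.comp_one i p)
  comp_parallel := by
    rintro I J K _ _ _ i j hij ⟨p⟩ ⟨q⟩ ⟨r⟩
    exact congrArg (Quotient.mk _) (O.comp_parallel hij p q r)
  comp_nested := by
    rintro I J K _ _ _ i j ⟨p⟩ ⟨q⟩ ⟨r⟩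
    exact congrArg (Quotient.mk _) (O.comp_nested i j p q r)

/-- The class of an element in a quotient operad. -/
def SetOperad.toQuotient (O : SetOperad.{u})
    (R : (I : Type) → [Finite I] → O.obj I → O.obj I → Prop) {I : Type} [Finite I]
    (x : O.obj I) : (O.quotient R).obj I :=
  Quotient.mk (O.congSetoid R I) x

/-- A set operad is binary quadratic if it has a presentation by generators of degree `2` and
relations of degree `3` (between compositions of these generators). -/
def SetOperad.IsBinaryQuadratic (O : SetOperad.{u}) : Prop :=
  ∃ (E : Species.{u})
    (R : (I : Type) → [Finite I] → (FreeOperad E).obj I → (FreeOperad E).obj I → Prop)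
    (φ : ((FreeOperad E).quotient R).Hom O),
    (∀ (I : Type) [Finite I], Nonempty (E.obj I) → Nat.card I = 2) ∧
    (∀ (I : Type) [Finite I] (x y : (FreeOperad E).obj I), R I x y → Nat.card I = 3) ∧
    φ.IsIso

/-! ## Shrubs -/

/-- A shrub on a non-empty set `I` (used only for finite `I`): a graph on `I` with a height function, such that
adjacent vertices have heights differing by one, every vertex of positive height is adjacent to
one just below it, and two induced subgraphs are forbidden (up to a shift of the height):
* `a, b` at height `k + 1` and `c, d, e` at height `k`, with edges `a-c, a-d, b-d, b-e` only;
* `a` at height `k + 2`, `b, c` at height `k + 1` and `d` at height `k`, with edges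
  `a-b, a-c, b-d` only.
(The vertices of such a configuration are automatically distinct, and there are no edges between
vertices whose heights do not differ by one.) -/
@[ext]
structure Shrub (I : Type) where
  nonempty : Nonempty I
  graph : SimpleGraph I
  height : I → ℕ
  height_adj : ∀ i j, graph.Adj i j → height i = height j + 1 ∨ height j = height i + 1
  exists_below : ∀ j, 0 < height j → ∃ i, graph.Adj i j ∧ height j = height i + 1
  no_five : ∀ a b c d e, height a = height c + 1 → height b = height c + 1 →
    height d = height c → height e = height c →
    ¬ (graph.Adj a c ∧ graph.Adj a d ∧ graph.Adj b d ∧ graph.Adj b e ∧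
      ¬ graph.Adj a e ∧ ¬ graph.Adj b c)
  no_four : ∀ a b c d, height a = height d + 2 → height b = height d + 1 →
    height c = height d + 1 →
    ¬ (graph.Adj a b ∧ graph.Adj a c ∧ graph.Adj b d ∧ ¬ graph.Adj c d)

namespace Shrub

/-- Relabelling of a shrub along a bijection. -/
def map {I J : Type} (e : I ≃ J) (P : Shrub I) : Shrub J where
  nonempty := P.nonempty.map e
  graph := P.graph.comap e.symm
  height j := P.height (e.symm j)
  height_adj i j h := P.height_adj _ _ h
  exists_below j h := by
    obtain ⟨i, hi, hh⟩ := P.exists_below _ h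
    exact ⟨e i, by simpa using hi, by simpa using hh⟩
  no_five a b c d e' := P.no_five _ _ _ _ _
  no_four a b c d := P.no_four _ _ _ _

/-- The forest of trivial shrubs on `I`: no edges, all heights are zero. -/
def points (I : Type) [Nonempty I] : Shrub I where
  nonempty := inferInstance
  graph := ⊥
  height _ := 0
  height_adj := by simp
  exists_below := by simp
  no_five := by simp
  no_four := by simp

/-- The rooted edge: the rooted tree on two vertices with root `0`. -/
def rootedEdge : Shrub (Fin 2) where
  nonempty := inferInstance
  graph := ⊤
  height i := i.val
  height_adj := by decide
  exists_below := by decide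
  no_five := by decide
  no_four := by decide

/-- The vertices adjacent in the composition `P ∘_i Q`: the edges of `P` away from `i`, the edges
of `Q`, and all edges between a neighbour of `i` in `P` and a vertex of height zero of `Q`. -/
def compAdj {I J : Type} (i : I) (P : Shrub I) (Q : Shrub J) :
    {x : I // x ≠ i} ⊕ J → {x : I // x ≠ i} ⊕ J → Prop
  | Sum.inl x, Sum.inl y => P.graph.Adj x y
  | Sum.inl x, Sum.inr y => P.graph.Adj x i ∧ Q.height y = 0
  | Sum.inr x, Sum.inl y => P.graph.Adj y i ∧ Q.height x = 0
  | Sum.inr x, Sum.inr y => Q.graph.Adj x y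

/-- The height function of the composition `P ∘_i Q`. -/
def compHeight {I J : Type} (i : I) (P : Shrub I) (Q : Shrub J) :
    {x : I // x ≠ i} ⊕ J → ℕ
  | Sum.inl x => P.height x
  | Sum.inr y => Q.height y + P.height i

theorem exists_height_zero {J : Type} (Q : Shrub J) : ∃ y, Q.height y = 0 := by
  obtain ⟨y⟩ := Q.nonempty
  obtain ⟨n, hn⟩ : ∃ n, Q.height y = n := ⟨_, rfl⟩
  induction n generalizing y with
  | zero => exact ⟨y, hn⟩
  | succ n ih =>
    obtain ⟨z, -, hz⟩ := Q.exists_below y (by omega)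
    exact ih z (by omega)

/-- The composition `P ∘_i Q` of shrubs. -/
def comp {I J : Type} (i : I) (P : Shrub I) (Q : Shrub J) : Shrub ({x : I // x ≠ i} ⊕ J) where
  nonempty := Q.nonempty.map Sum.inr
  graph :=
    { Adj := compAdj i P Q
      symm := ⟨by rintro (x | x) (y | y) h <;> simp_all [compAdj, SimpleGraph.adj_comm]⟩
      loopless := ⟨by rintro (x | x) h <;> simp_all [compAdj]⟩ }
  height := compHeight i P Q
  height_adj := by
    rintro (x | x) (y | y) h
    · exact P.height_adj _ _ h
    · have := P.height_adj _ _ h.1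
      have := h.2
      simp only [compHeight]; omega
    · have := P.height_adj _ _ h.1
      have := h.2
      simp only [compHeight]; omega
    · have := Q.height_adj _ _ h
      simp only [compHeight]; omega
  exists_below := by
    rintro (x | x) h
    · obtain ⟨y, hy, hh⟩ := P.exists_below _ h
      by_cases e : y = i
      · subst e
        obtain ⟨z, hz⟩ := Q.exists_height_zero
        exact ⟨Sum.inr z, ⟨hy.symm, hz⟩, by simp only [compHeight]; omega⟩
      · exact ⟨Sum.inl ⟨y, e⟩, hy, hh⟩
    · by_cases h0 : Q.height x = 0
      · obtain ⟨y, hy, hh⟩ := P.exists_below i (by simp only [compHeight] at h; omega)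
        exact ⟨Sum.inl ⟨y, hy.ne⟩, ⟨hy, h0⟩, by simp only [compHeight]; omega⟩
      · obtain ⟨y, hy, hh⟩ := Q.exists_below x (by omega)
        exact ⟨Sum.inr y, hy, by simp only [compHeight]; omega⟩
  no_five := by
    rintro a b c d e h1 h2 h3 h4 ⟨h5, h6, h7, h8, h9, h10⟩
    have key := P.no_five (Sum.elim (fun x => x.1) (fun _ => i) a)
      (Sum.elim (fun x => x.1) (fun _ => i) b) (Sum.elim (fun x => x.1) (fun _ => i) c)
      (Sum.elim (fun x => x.1) (fun _ => i) d) (Sum.elim (fun x => x.1) (fun _ => i) e)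
    have hP : ∀ x, P.graph.Adj x i → P.height x = P.height i + 1 ∨ P.height i = P.height x + 1 :=
      fun x => P.height_adj x i
    have hs : ∀ x, P.graph.Adj i x ↔ P.graph.Adj x i := fun x => P.graph.adj_comm i x
    rcases a with a | a <;> rcases b with b | b <;> rcases c with c | c <;>
      rcases d with d | d <;> rcases e with e | e <;>
      simp only [compAdj, compHeight, Sum.elim_inl, Sum.elim_inr, hs] at * <;>
      first
        | exact Q.no_five a b c d e (by omega) (by omega) (by omega) (by omega)
            ⟨h5, h6, h7, h8, h9, h10⟩
        | grind
  no_four := by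
    rintro a b c d h1 h2 h3 ⟨h5, h6, h7, h8⟩
    have key := P.no_four (Sum.elim (fun x => x.1) (fun _ => i) a)
      (Sum.elim (fun x => x.1) (fun _ => i) b) (Sum.elim (fun x => x.1) (fun _ => i) c)
      (Sum.elim (fun x => x.1) (fun _ => i) d)
    have hP : ∀ x, P.graph.Adj x i → P.height x = P.height i + 1 ∨ P.height i = P.height x + 1 :=
      fun x => P.height_adj x i
    have hs : ∀ x, P.graph.Adj i x ↔ P.graph.Adj x i := fun x => P.graph.adj_comm i x
    rcases a with a | a <;> rcases b with b | b <;> rcases c with c | c <;>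
      rcases d with d | d <;>
      simp only [compAdj, compHeight, Sum.elim_inl, Sum.elim_inr, hs] at * <;>
      first
        | exact Q.no_four a b c d (by omega) (by omega) (by omega) ⟨h5, h6, h7, h8⟩
        | grind

end Shrub

/-- The operad `Arb` of shrubs. -/
def Arb : SetOperad.{0} where
  obj I _ := Shrub I
  map e P := P.map e
  map_refl _ := rfl
  map_trans _ _ _ := rfl
  one := Shrub.points Unit
  comp i P Q := Shrub.comp i P Q
  comp_map := by
    intro I I' J J' _ _ _ _ e f i P Q
    ext x y
    · rcases x with x | x <;> rcases y with y | y <;>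
        simp [Shrub.comp, Shrub.map, Shrub.compAdj, compCongr]
    · rcases x with x | x <;> simp [Shrub.comp, Shrub.map, Shrub.compHeight, compCongr]
  one_comp := by
    intro J _ Q
    ext x y
    · exact Iff.rfl
    · exact Nat.add_zero _
  comp_one := by
    intro I _ i P
    ext x y
    · by_cases hx : x = i <;> by_cases hy : y = i <;>
        simp [Shrub.comp, Shrub.map, Shrub.compAdj, unitRight, Shrub.points, hx, hy,
          SimpleGraph.adj_comm]
    · by_cases hx : x = i <;>
        simp [Shrub.comp, Shrub.map, Shrub.compHeight, unitRight, Shrub.points, hx]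
  comp_parallel := by
    intro I J K _ _ _ i j hij P Q R
    ext x y
    · rcases x with ⟨x | x, hx⟩ | x <;> rcases y with ⟨y | y, hy⟩ | y <;>
        simp [Shrub.comp, Shrub.map, Shrub.compAdj, Shrub.compHeight, parallelEquiv,
          SimpleGraph.adj_comm, and_comm, and_assoc, and_left_comm]
    · rcases x with ⟨x | x, hx⟩ | x <;>
        simp [Shrub.comp, Shrub.map, Shrub.compHeight, parallelEquiv]
  comp_nested := by
    intro I J K _ _ _ i j P Q R
    ext x y
    · rcases x with x | ⟨x, hx⟩ | x <;> rcases y with y | ⟨y, hy⟩ | y <;>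
        simp [Shrub.comp, Shrub.map, Shrub.compAdj, Shrub.compHeight, nestedEquiv,
          and_comm, and_assoc]
    · rcases x with x | ⟨x, hx⟩ | x <;>
        simp [Shrub.comp, Shrub.map, Shrub.compHeight, nestedEquiv, add_assoc]

/-! ## The presentation -/

/-- For `p, q` on the two-element set `{0, 1}`: the composition `p(q(x, y), z)`, i.e. the
composition of `q` at the vertex `0` of `p`, where the labels `0, 1` of `q` become `x, y` and the
label `1` of `p` becomes `z`. Here `x, y, z` are the three elements of `Fin 3`, in some order. -/
noncomputable def SetOperad.leftComp (O : SetOperad.{u}) (p q : O.obj (Fin 2)) (x y z : Fin 3)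
    (h : Function.Bijective
      (Sum.elim (fun _ => z) ![x, y] : {k : Fin 2 // k ≠ 0} ⊕ Fin 2 → Fin 3) := by decide) :
    O.obj (Fin 3) :=
  O.map (Equiv.ofBijective _ h) (O.comp 0 p q)

/-- For `p, q` on the two-element set `{0, 1}`: the composition `p(x, q(y, z))`, i.e. the
composition of `q` at the vertex `1` of `p`, where the label `0` of `p` becomes `x` and the labels
`0, 1` of `q` become `y, z`. -/
noncomputable def SetOperad.rightComp (O : SetOperad.{u}) (p q : O.obj (Fin 2)) (x y z : Fin 3)
    (h : Function.Bijective
      (Sum.elim (fun _ => x) ![y, z] : {k : Fin 2 // k ≠ 1} ⊕ Fin 2 → Fin 3) := by decide) :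
    O.obj (Fin 3) :=
  O.map (Equiv.ofBijective _ h) (O.comp 1 p q)

/-- The generators: on a two-element set `I`, one element `C` (symmetric, so that
`C_{a,b} = C_{b,a}`) and, for each `r` in `I`, one element `D r` (which is `D_{r,s}` for
`I = {r, s}`); no generator on other sets. -/
inductive ArbGen (I : Type) : Type
  | C (h : Nat.card I = 2) : ArbGen I
  | D (h : Nat.card I = 2) (r : I) : ArbGen I

/-- The species of generators. -/
def arbGen : Species.{0} where
  obj I _ := ArbGen I
  map e
    | .C h => .C (Nat.card_congr e ▸ h)
    | .D h r => .D (Nat.card_congr e ▸ h) (e r)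
  map_refl := by rintro I _ (_ | _) <;> rfl
  map_trans := by rintro I J K _ _ _ e f (_ | _) <;> rfl

/-- The generator `C_{0,1} = C_{1,0}` in the free operad. -/
def genC : (FreeOperad arbGen).obj (Fin 2) :=
  FreeOperad.gen (E := arbGen) (ArbGen.C (by simp))

/-- The generator `D_{0,1}` in the free operad. -/
def genD : (FreeOperad arbGen).obj (Fin 2) :=
  FreeOperad.gen (E := arbGen) (ArbGen.D (by simp) 0)

/-- The quadratic relations (with the labels `0, 1, 2`):
`D(D(2, 1), 0) = D(D(2, 0), 1) = D(2, C(0, 1))` and `C(C(1, 2), 0) = C(C(2, 0), 1)`. -/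
inductive ArbRel : (I : Type) → [Finite I] →
    (FreeOperad arbGen).obj I → (FreeOperad arbGen).obj I → Prop
  | nap_left : ArbRel (Fin 3) ((FreeOperad arbGen).leftComp genD genD 2 1 0)
      ((FreeOperad arbGen).leftComp genD genD 2 0 1)
  | nap_right : ArbRel (Fin 3) ((FreeOperad arbGen).leftComp genD genD 2 0 1)
      ((FreeOperad arbGen).rightComp genD genC 2 0 1)
  | comm : ArbRel (Fin 3) ((FreeOperad arbGen).leftComp genC genC 1 2 0)
      ((FreeOperad arbGen).leftComp genC genC 2 0 1)

/-- The operad presented by the generators `C`, `D` and the quadratic relations. -/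
def PresentedArb : SetOperad.{1} := (FreeOperad arbGen).quotient ArbRel

/-- The class of `C_{0,1}` in the presented operad. -/
def PresentedArb.C : PresentedArb.obj (Fin 2) := (FreeOperad arbGen).toQuotient ArbRel genC

/-- The class of `D_{0,1}` in the presented operad. -/
def PresentedArb.D : PresentedArb.obj (Fin 2) := (FreeOperad arbGen).toQuotient ArbRel genD

/-- The shrub `[0][1]`: disjoint union of two trivial shrubs. -/
def Arb.union : Arb.obj (Fin 2) := Shrub.points (Fin 2)

/-- The shrub `[0 ◁ 1]`: the rooted edge with root `0`. -/
def Arb.edge : Arb.obj (Fin 2) := Shrub.rootedEdge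

/-!
An algebra over the operad presented by `C` and `D` is a commutative semigroup together with an
action of this semigroup on its own underlying set: the relations say that `a · b = C(a, b)` is
commutative and associative, and that `a ◁ b = D(a, b)` satisfies `(a ◁ b) ◁ c = a ◁ (b · c)`.
For shrubs `a · b` is the disjoint union, and `a ◁ b` puts `b` on top of `a`, with all edges between
the vertices of height zero of `a` and those of `b`. So the theorem says that shrubs on `I` are the
multilinear elements of the free such algebra on `I`.

Elements of an operad that are generated by two binary operations are written as expressions
`BTree` in labelled leaves. The generated elements are closed under composition
(`SetOperad.Rep.comp`), so every element of the presented operad is the value of an expression in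
which each label occurs once (`SetOperad.Rep.exists_tree`), and expressions that are congruent under
the relations have equal values (`BTree.Cong.exists_equiv`). Two facts about shrubs remain.

* Existence (`Shrub.IsPiece.exists_tree`): every shrub is described by an expression. A disconnected
  shrub is a disjoint union. In a connected shrub with several vertices, the second forbidden
  configuration shows that the set of roots below a vertex of positive height is constant along the
  edges between such vertices, and the first one shows that these sets are pairwise disjoint or
  comparable. By connectedness a maximal one contains all the roots. Take a vertex of height one
  adjacent to all roots and its component `T` among the vertices of positive height; the shrub is
  then `T` put on top of the rest.
* Uniqueness (`BTree.SameShrub.cong`): expressions that describe the same shrub are congruent. The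
  relations allow one to assume that an expression is `a · b` with `a` the connected component of a
  chosen vertex, or `a ◁ b` with `a` not itself of the form `a₁ ◁ a₂`. In both cases the shrub
  determines the vertex sets of `a` and `b` (`BTree.SameShrub.supp_subset_of_union`,
  `BTree.SameShrub.supp_subset_of_graft`), and induction applies to `a` and `b`.
-/

/-! ### Binary operations in an operad -/

namespace SetOperad

/-- The bijection of `compCongr`, with the image of `i` under `e` given by a name of its own. -/
def compEquiv {I I' J J' : Type} (e : I ≃ I') (f : J ≃ J') {i : I} {i' : I'} (h : e i = i') :
    ({x : I // x ≠ i} ⊕ J) ≃ ({x : I' // x ≠ i'} ⊕ J') :=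
  Equiv.sumCongr (e.subtypeEquiv fun a => by simp [← h]) f

variable (O : SetOperad.{u})

theorem comp_map_of {I I' J J' : Type} [Finite I] [Finite I'] [Finite J] [Finite J']
    (e : I ≃ I') (f : J ≃ J') {i : I} {i' : I'} (h : e i = i') (p : O.obj I) (q : O.obj J) :
    O.comp i' (O.map e p) (O.map f q) = O.map (compEquiv e f h) (O.comp i p q) := by
  subst h
  exact O.comp_map e f i p q

theorem comp_map_left {I I' J : Type} [Finite I] [Finite I'] [Finite J]
    (e : I ≃ I') {i : I} {i' : I'} (h : e i = i') (p : O.obj I) (q : O.obj J) :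
    O.comp i' (O.map e p) q = O.map (compEquiv e (Equiv.refl J) h) (O.comp i p q) := by
  rw [← comp_map_of, O.map_refl]

theorem comp_map_right {I J J' : Type} [Finite I] [Finite J] [Finite J']
    (f : J ≃ J') (i : I) (p : O.obj I) (q : O.obj J) :
    O.comp i p (O.map f q) =
      O.map (compEquiv (i' := i) (Equiv.refl I) f (Equiv.refl_apply i)) (O.comp i p q) := by
  rw [← comp_map_of, O.map_refl]

theorem map_map {I J K : Type} [Finite I] [Finite J] [Finite K] (e : I ≃ J) (f : J ≃ K)
    (x : O.obj I) : O.map f (O.map e x) = O.map (e.trans f) x :=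
  (O.map_trans e f x).symm

theorem map_symm_map {I J : Type} [Finite I] [Finite J] (e : I ≃ J) (x : O.obj I) :
    O.map e.symm (O.map e x) = x := by
  rw [map_map, Equiv.self_trans_symm, O.map_refl]

theorem map_injective {I J : Type} [Finite I] [Finite J] (e : I ≃ J) :
    Function.Injective (O.map e) := fun x y h => by
  rw [← O.map_symm_map e x, h, O.map_symm_map]

theorem comp_nested_symm {I J K : Type} [Finite I] [Finite J] [Finite K] (i : I) (j : J)
    (p : O.obj I) (q : O.obj J) (r : O.obj K) :
    O.comp (Sum.inr j) (O.comp i p q) r =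
      O.map (nestedEquiv i j).symm (O.comp i p (O.comp j q r)) := by
  rw [← O.comp_nested, map_symm_map]

theorem comp_parallel_symm {I J K : Type} [Finite I] [Finite J] [Finite K] {i j : I}
    (hij : i ≠ j) (p : O.obj I) (q : O.obj J) (r : O.obj K) :
    O.comp (Sum.inl ⟨j, hij.symm⟩) (O.comp i p q) r =
      O.map (parallelEquiv hij).symm (O.comp (Sum.inl ⟨i, hij⟩) (O.comp j p r) q) := by
  rw [← O.comp_parallel hij, map_symm_map]

/-- After substitutions of `J` for `0` and of `K` for `1` in the label set `{0, 1}`, the labels are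
those of `J ⊔ K`. -/
def binEquiv (J K : Type) :
    ({x : {k : Fin 2 // k ≠ 0} ⊕ J // x ≠ Sum.inl ⟨1, one_ne_zero⟩} ⊕ K) ≃ J ⊕ K where
  toFun
    | Sum.inl ⟨Sum.inl k, h⟩ => (h (by obtain ⟨k, hk⟩ := k; congr; omega)).elim
    | Sum.inl ⟨Sum.inr y, _⟩ => Sum.inl y
    | Sum.inr z => Sum.inr z
  invFun
    | Sum.inl y => Sum.inl ⟨Sum.inr y, by simp⟩
    | Sum.inr z => Sum.inr z
  left_inv := by
    rintro (⟨k | y, h⟩ | z)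
    · exact (h (by obtain ⟨k, hk⟩ := k; congr; omega)).elim
    · rfl
    · rfl
  right_inv := by rintro (y | z) <;> rfl

/-- The value `p(s, t)` of a binary operation `p` on the labels `0, 1`. -/
def bin {J K : Type} [Finite J] [Finite K] (p : O.obj (Fin 2)) (s : O.obj J) (t : O.obj K) :
    O.obj (J ⊕ K) :=
  O.map (binEquiv J K) (O.comp (Sum.inl ⟨1, one_ne_zero⟩) (O.comp 0 p s) t)

theorem comp_comp_eq_map_bin {J K : Type} [Finite J] [Finite K] (p : O.obj (Fin 2))
    (s : O.obj J) (t : O.obj K) : O.comp (Sum.inl ⟨1, one_ne_zero⟩) (O.comp 0 p s) t =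
      O.map (binEquiv J K).symm (O.bin p s t) :=
  (O.map_symm_map _ _).symm

theorem bin_map {J J' K K' : Type} [Finite J] [Finite K] [Finite J'] [Finite K']
    (p : O.obj (Fin 2)) (e : J ≃ J') (f : K ≃ K') (s : O.obj J) (t : O.obj K) :
    O.bin p (O.map e s) (O.map f t) = O.map (Equiv.sumCongr e f) (O.bin p s t) := by
  unfold bin
  rw [comp_map_right, comp_map_right, comp_map_left (i := Sum.inl ⟨1, one_ne_zero⟩) (h := ?_),
    map_map, map_map, map_map]
  rotate_left
  · rfl
  congr 1
  ext (⟨k | y, h⟩ | z)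
  · exact (h (by obtain ⟨k, hk⟩ := k; congr; omega)).elim
  · rfl
  · rfl

/-- Exchanging the two labels of `p` exchanges its arguments. -/
theorem bin_swap {J K : Type} [Finite J] [Finite K]
    (p : O.obj (Fin 2)) (s : O.obj J) (t : O.obj K) :
    O.bin (O.map (Equiv.swap 0 1) p) t s = O.map (Equiv.sumComm J K) (O.bin p s t) := by
  unfold bin
  rw [comp_map_left (i := (1 : Fin 2)) (h := by simp),
    comp_map_left (i := Sum.inl ⟨(0 : Fin 2), zero_ne_one⟩) (h := ?_),
    ← O.comp_parallel (zero_ne_one), map_map, map_map, map_map]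
  rotate_left
  · rfl
  congr 1
  ext (⟨k | y, h⟩ | z)
  · exact (h (by obtain ⟨k, hk⟩ := k; congr; omega)).elim
  · rfl
  · rfl

/-- A relation `p(q(x, y), z) = p'(x, q'(y, z))` between binary operations persists when
arbitrary elements are substituted for the three labels. -/
theorem bin_bin_of_comp_eq (p q p' q' : O.obj (Fin 2))
    (τ : ({k : Fin 2 // k ≠ 1} ⊕ Fin 2) ≃ ({k : Fin 2 // k ≠ 0} ⊕ Fin 2))
    (h0 : τ (Sum.inl ⟨0, zero_ne_one (α := Fin 2)⟩) = Sum.inr 0) (h1 : τ (Sum.inr 0) = Sum.inr 1)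
    (h2 : τ (Sum.inr 1) = Sum.inl ⟨1, one_ne_zero (α := Fin 2)⟩)
    (hW : O.comp 0 p q = O.map τ (O.comp 1 p' q'))
    {J K L : Type} [Finite J] [Finite K] [Finite L] (r : O.obj J) (s : O.obj K) (t : O.obj L) :
    O.map (Equiv.sumAssoc J K L) (O.bin p (O.bin q r s) t) = O.bin p' r (O.bin q' s t) := by
  -- the places for `r`, `s` and `t` in `p'(x, q'(y, z))`; both sides become relabellings of
  -- the substitution of `r`, `s` and `t` at these places, one after the other
  let a : {k : Fin 2 // k ≠ 1} ⊕ Fin 2 := Sum.inl ⟨0, zero_ne_one⟩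
  let b : {x // x ≠ a} ⊕ J := Sum.inl ⟨Sum.inr 0, by simp [a]⟩
  let c : {x // x ≠ b} ⊕ K := Sum.inl ⟨Sum.inl ⟨Sum.inr 1, by simp [a]⟩, by simp [b]⟩
  have hb : parallelEquiv (one_ne_zero (α := Fin 2)) b = Sum.inr (0 : Fin 2) := rfl
  have e1 : O.comp (Sum.inl ⟨1, one_ne_zero⟩) (O.comp 0 p' r) q' =
    O.map (parallelEquiv one_ne_zero) (O.comp a (O.comp 1 p' q') r) :=
      (O.comp_parallel one_ne_zero _ _ _).symm
  have e2 := O.comp_map_left (parallelEquiv one_ne_zero) hb (O.comp a (O.comp 1 p' q') r) s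
  obtain ⟨E, hE⟩ : ∃ E, E = (compEquiv (parallelEquiv one_ne_zero) (Equiv.refl K) hb).trans
    (nestedEquiv (Sum.inl (⟨1, one_ne_zero⟩ : {k : Fin 2 // k ≠ 0})) (0 : Fin 2)) := ⟨_, rfl⟩
  have e3 : O.comp (Sum.inl ⟨1, one_ne_zero⟩) (O.comp 0 p' r) (O.comp 0 q' s) =
      O.map E (O.comp b (O.comp a (O.comp 1 p' q') r) s) := by
    rw [← O.comp_nested, e1, e2, map_map, hE]
  have hc : E c = Sum.inr (Sum.inl ⟨1, one_ne_zero⟩) := by rw [hE]; rfl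
  have e4 := O.comp_map_left E hc (O.comp b (O.comp a (O.comp 1 p' q') r) s) t
  have e5 : O.comp (Sum.inl ⟨1, one_ne_zero⟩) (O.comp 0 p' r)
      (O.comp (Sum.inl ⟨1, one_ne_zero⟩) (O.comp 0 q' s) t) = O.map ((compEquiv E (Equiv.refl L)
        hc).trans (nestedEquiv _ _)) (O.comp c (O.comp b (O.comp a (O.comp 1 p' q') r) s) t) := by
    rw [← O.comp_nested, e3, ← map_map, ← e4]
  unfold bin
  rw [comp_map_right (i := Sum.inl _), e5]
  rw [comp_map_right (i := (0 : Fin 2)), ← O.comp_nested, ← O.comp_nested, hW,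
    comp_map_left (i := a) (h := h0)]
  simp only [map_map]
  rw [comp_map_left (i := b) (h := ?_)]
  rotate_left
  · simp [a, b, compEquiv, h1, nestedEquiv]
  simp only [map_map]
  rw [comp_map_left (i := c) (h := ?_)]
  rotate_left
  · simp [a, b, c, compEquiv, h2, nestedEquiv, binEquiv]
  subst hE
  simp only [map_map]
  congr 1
  ext ((⟨⟨⟨⟨k, hk⟩ | k, h⟩ | y, h'⟩ | y, h''⟩) | y)
  · exact (h (by simp only [a]; congr; omega)).elim
  · exfalso
    fin_cases k
    · exact h' rfl
    · exact h'' rfl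
  · rfl
  · rfl
  · rfl

/-- Substitution into the first argument of a binary operation; the bijection of labels is not made
explicit. -/
theorem comp_inl_bin {J K L : Type} [Finite J] [Finite K] [Finite L] (p : O.obj (Fin 2))
    (s : O.obj J) (t : O.obj K) (j : J) (q : O.obj L) :
    ∃ e, O.comp (Sum.inl j) (O.bin p s t) q = O.map e (O.bin p (O.comp j s q) t) := by
  conv in O.comp (Sum.inl j) _ _ => unfold bin
  have hj : binEquiv J K (Sum.inl ⟨Sum.inr j, Sum.inr_ne_inl⟩) = Sum.inl j := rfl
  rw [O.comp_map_left _ hj]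
  have hpar := O.comp_parallel_symm
    (Sum.inl_ne_inr (a := (⟨1, one_ne_zero⟩ : {k : Fin 2 // k ≠ 0})) (b := j)) (O.comp 0 p s) t q
  have hn : (nestedEquiv (K := L) (0 : Fin 2) j).symm (Sum.inl ⟨1, one_ne_zero⟩) =
    Sum.inl ⟨Sum.inl ⟨1, one_ne_zero⟩, Sum.inl_ne_inr⟩ := rfl
  rw [comp_nested_symm, O.comp_map_left _ hn, O.comp_comp_eq_map_bin p (O.comp j s q)] at hpar
  rw [hpar]
  simp only [map_map]
  exact ⟨_, rfl⟩

/-- Substitution into the second argument of a binary operation; the bijection of labels is not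
made explicit. -/
theorem comp_inr_bin {J K L : Type} [Finite J] [Finite K] [Finite L] (p : O.obj (Fin 2))
    (s : O.obj J) (t : O.obj K) (k : K) (q : O.obj L) :
    ∃ e, O.comp (Sum.inr k) (O.bin p s t) q = O.map e (O.bin p s (O.comp k t q)) := by
  conv in O.comp (Sum.inr k) _ _ => unfold bin
  rw [comp_map_left (i := Sum.inr k) (h := ?_)]
  rotate_left
  · rfl
  rw [comp_nested_symm, comp_comp_eq_map_bin]
  simp only [map_map]
  exact ⟨_, rfl⟩

/-- Substituting the unit for both labels changes nothing. -/
theorem exists_eq_map_bin_one (p : O.obj (Fin 2)) :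
    ∃ e : Unit ⊕ Unit ≃ Fin 2, O.map e (O.bin p O.one O.one) = p := by
  refine ⟨((binEquiv Unit Unit).symm.trans (unitRight _)).trans (unitRight 0), ?_⟩
  rw [bin, map_map]
  have : (binEquiv Unit Unit).trans (((binEquiv Unit Unit).symm.trans (unitRight _)).trans
      (unitRight 0)) = (unitRight (Sum.inl ⟨1, one_ne_zero⟩)).trans (unitRight 0) := by
    ext x; simp
  rw [this, ← map_map, O.comp_one, O.comp_one]

/-- The elements obtained from the unit by relabelling and by the two binary operations
`c` and `d`. -/
inductive Rep (c d : O.obj (Fin 2)) : (I : Type) → [Finite I] → O.obj I → Prop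
  | one : Rep c d Unit O.one
  | map {I J : Type} [Finite I] [Finite J] (e : I ≃ J) {x : O.obj I} :
      Rep c d I x → Rep c d J (O.map e x)
  | left {I J : Type} [Finite I] [Finite J] {x : O.obj I} {y : O.obj J} :
      Rep c d I x → Rep c d J y → Rep c d (I ⊕ J) (O.bin c x y)
  | right {I J : Type} [Finite I] [Finite J] {x : O.obj I} {y : O.obj J} :
      Rep c d I x → Rep c d J y → Rep c d (I ⊕ J) (O.bin d x y)

variable {O} in
/-- The elements generated from the unit by two binary operations form a suboperad. -/
theorem Rep.comp {c d : O.obj (Fin 2)} {I J : Type} [Finite I] [Finite J] {x : O.obj I}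
    {y : O.obj J} (hx : O.Rep c d I x) (hy : O.Rep c d J y) (i : I) :
    O.Rep c d _ (O.comp i x y) := by
  induction hx with
  | one =>
    rw [← O.map_symm_map (unitLeft J) (O.comp _ _ y)]
    exact .map (unitLeft J).symm (by rw [O.one_comp]; exact hy)
  | map e _ ih =>
    rw [O.comp_map_left e (i := e.symm i) (i' := i) (e.apply_symm_apply i)]
    exact .map (compEquiv e (Equiv.refl J) (e.apply_symm_apply i)) (ih _)
  | @left _ _ _ _ s t hs ht ihs iht =>
    rcases i with i | i
    · obtain ⟨e, he⟩ := O.comp_inl_bin c s t i y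
      rw [he]
      exact .map e (.left (ihs i) ht)
    · obtain ⟨e, he⟩ := O.comp_inr_bin c s t i y
      rw [he]
      exact .map e (.left hs (iht i))
  | @right _ _ _ _ s t hs ht ihs iht =>
    rcases i with i | i
    · obtain ⟨e, he⟩ := O.comp_inl_bin d s t i y
      rw [he]
      exact .map e (.right (ihs i) ht)
    · obtain ⟨e, he⟩ := O.comp_inr_bin d s t i y
      rw [he]
      exact .map e (.right hs (iht i))

end SetOperad

/-! ### Expressions in two binary operations -/

/-- Formal expressions in labels from `X` and two binary operations: a symmetric one (`union`,
for `[a][b]`) and a grafting (`graft`, for `[a ◁ b]`). Labels may be repeated. -/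
inductive BTree (X : Type) : Type
  | leaf (x : X) : BTree X
  | union (a b : BTree X) : BTree X
  | graft (a b : BTree X) : BTree X

namespace BTree

variable {X Y : Type}

/-- The set of leaves of an expression. -/
def Pos : BTree X → Type
  | leaf _ => Unit
  | union a b => a.Pos ⊕ b.Pos
  | graft a b => a.Pos ⊕ b.Pos

instance instFinitePos : (t : BTree X) → Finite t.Pos
  | leaf _ => inferInstanceAs (Finite Unit)
  | union a b =>
    have := instFinitePos a
    have := instFinitePos b
    inferInstanceAs (Finite (a.Pos ⊕ b.Pos))
  | graft a b =>
    have := instFinitePos a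
    have := instFinitePos b
    inferInstanceAs (Finite (a.Pos ⊕ b.Pos))

/-- The label of a leaf. -/
def lab : (t : BTree X) → t.Pos → X
  | leaf x => fun _ => x
  | union a b => Sum.elim a.lab b.lab
  | graft a b => Sum.elim a.lab b.lab

/-- Renaming of the labels. -/
def map (f : X → Y) : BTree X → BTree Y
  | leaf x => leaf (f x)
  | union a b => union (a.map f) (b.map f)
  | graft a b => graft (a.map f) (b.map f)

/-- The value of an expression in an operad with two chosen binary operations, as an element on
the set of leaves. -/
def eval (O : SetOperad.{u}) (c d : O.obj (Fin 2)) : (t : BTree X) → O.obj t.Pos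
  | leaf _ => O.one
  | union a b => O.bin c (a.eval O c d) (b.eval O c d)
  | graft a b => O.bin d (a.eval O c d) (b.eval O c d)

/-- The congruence on expressions generated by commutativity and associativity of `union`, and by
`(a ◁ b) ◁ c = a ◁ (b ∪ c)`. -/
inductive Cong : BTree X → BTree X → Prop
  | refl (a : BTree X) : Cong a a
  | symm {a b : BTree X} : Cong a b → Cong b a
  | trans {a b c : BTree X} : Cong a b → Cong b c → Cong a c
  | union {a a' b b' : BTree X} : Cong a a' → Cong b b' → Cong (union a b) (union a' b')
  | graft {a a' b b' : BTree X} : Cong a a' → Cong b b' → Cong (graft a b) (graft a' b')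
  | union_comm (a b : BTree X) : Cong (.union a b) (.union b a)
  | union_assoc (a b c : BTree X) : Cong (.union (.union a b) c) (.union a (.union b c))
  | graft_graft (a b c : BTree X) : Cong (.graft (.graft a b) c) (.graft a (.union b c))

end BTree

namespace SetOperad

/-- The bijection between the labels of `p'(x, q'(y, z))` and those of `p(q(x, y), z)` that
preserves `x`, `y` and `z`. -/
def cycleEquiv : ({k : Fin 2 // k ≠ 1} ⊕ Fin 2) ≃ ({k : Fin 2 // k ≠ 0} ⊕ Fin 2) where
  toFun := Sum.elim (fun _ => Sum.inr 0) ![Sum.inr 1, Sum.inl ⟨1, one_ne_zero⟩]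
  invFun := Sum.elim (fun _ => Sum.inr 1) ![Sum.inl ⟨0, zero_ne_one⟩, Sum.inr 0]
  left_inv := by decide
  right_inv := by decide

/-- `c` is a commutative and associative operation and `d` is an action of it:
`c(x, y) = c(y, x)`, `c(c(x, y), z) = c(x, c(y, z))` and `d(d(x, y), z) = d(x, c(y, z))`. -/
structure IsAction (O : SetOperad.{u}) (c d : O.obj (Fin 2)) : Prop where
  swap : O.map (Equiv.swap 0 1) c = c
  assoc : O.comp 0 c c = O.map cycleEquiv (O.comp 1 c c)
  act : O.comp 0 d d = O.map cycleEquiv (O.comp 1 d c)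

variable {O : SetOperad.{u}} {c d : O.obj (Fin 2)}

theorem IsAction.bin_comm (h : O.IsAction c d) {J K : Type} [Finite J] [Finite K]
    (s : O.obj J) (t : O.obj K) :
    O.map (Equiv.sumComm J K) (O.bin c s t) = O.bin c t s := by
  rw [← bin_swap, h.swap]

theorem IsAction.bin_assoc (h : O.IsAction c d) {J K L : Type} [Finite J] [Finite K] [Finite L]
    (r : O.obj J) (s : O.obj K) (t : O.obj L) :
    O.map (Equiv.sumAssoc J K L) (O.bin c (O.bin c r s) t) = O.bin c r (O.bin c s t) :=
  O.bin_bin_of_comp_eq c c c c cycleEquiv rfl rfl rfl h.assoc r s t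

theorem IsAction.bin_act (h : O.IsAction c d) {J K L : Type} [Finite J] [Finite K] [Finite L]
    (r : O.obj J) (s : O.obj K) (t : O.obj L) :
    O.map (Equiv.sumAssoc J K L) (O.bin d (O.bin d r s) t) = O.bin d r (O.bin c s t) :=
  O.bin_bin_of_comp_eq d d d c cycleEquiv rfl rfl rfl h.act r s t

end SetOperad

namespace BTree

variable {X Y : Type} {O : SetOperad.{u}} {c d : O.obj (Fin 2)}

/-- Congruent expressions have the same value, up to the bijection of their leaves that respects
the labels. -/
theorem Cong.exists_equiv (h : O.IsAction c d) {s t : BTree X} (hst : s.Cong t) :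
    ∃ e : s.Pos ≃ t.Pos, (∀ p, t.lab (e p) = s.lab p) ∧
      O.map e (s.eval O c d) = t.eval O c d := by
  induction hst with
  | refl a => exact ⟨Equiv.refl _, fun _ => rfl, O.map_refl _⟩
  | symm _ ih =>
    obtain ⟨e, he, hv⟩ := ih
    exact ⟨e.symm, fun p => by rw [← he, e.apply_symm_apply], by rw [← hv, O.map_symm_map]⟩
  | trans _ _ ih ih' =>
    obtain ⟨e, he, hv⟩ := ih
    obtain ⟨e', he', hv'⟩ := ih'
    exact ⟨e.trans e', fun p => by simp [he, he'], by rw [O.map_trans, hv, hv']⟩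
  | union _ _ ih ih' =>
    obtain ⟨e, he, hv⟩ := ih
    obtain ⟨e', he', hv'⟩ := ih'
    refine ⟨Equiv.sumCongr e e', ?_, ?_⟩
    · rintro (p | p)
      · exact he p
      · exact he' p
    · rw [eval, eval, ← hv, ← hv', O.bin_map]; rfl
  | graft _ _ ih ih' =>
    obtain ⟨e, he, hv⟩ := ih
    obtain ⟨e', he', hv'⟩ := ih'
    refine ⟨Equiv.sumCongr e e', ?_, ?_⟩
    · rintro (p | p)
      · exact he p
      · exact he' p
    · rw [eval, eval, ← hv, ← hv', O.bin_map]; rfl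
  | union_comm a b => exact ⟨Equiv.sumComm _ _, by rintro (p | p) <;> rfl, h.bin_comm _ _⟩
  | union_assoc a b c =>
    exact ⟨Equiv.sumAssoc _ _ _, by rintro ((p | p) | p) <;> rfl, h.bin_assoc _ _ _⟩
  | graft_graft a b c =>
    exact ⟨Equiv.sumAssoc _ _ _, by rintro ((p | p) | p) <;> rfl, h.bin_act _ _ _⟩

theorem rep_eval (O : SetOperad.{u}) (c d : O.obj (Fin 2)) :
    ∀ t : BTree X, O.Rep c d t.Pos (t.eval O c d)
  | leaf _ => .one
  | union a b => .left (rep_eval O c d a) (rep_eval O c d b)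
  | graft a b => .right (rep_eval O c d a) (rep_eval O c d b)

/-- Renaming the labels does not change the value, up to the bijection between the leaves. -/
theorem exists_equiv_map (O : SetOperad.{u}) (c d : O.obj (Fin 2)) (f : X → Y) (t : BTree X) :
    ∃ e : t.Pos ≃ (t.map f).Pos, (∀ p, (t.map f).lab (e p) = f (t.lab p)) ∧
      O.map e (t.eval O c d) = (t.map f).eval O c d := by
  induction t with
  | leaf x => exact ⟨Equiv.refl Unit, fun _ => rfl, O.map_refl _⟩
  | union a b ih ih' =>
    obtain ⟨e, he, hv⟩ := ih
    obtain ⟨e', he', hv'⟩ := ih'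
    refine ⟨Equiv.sumCongr e e', ?_, ?_⟩
    · rintro (p | p)
      · exact he p
      · exact he' p
    · change O.map _ (O.bin c _ _) = O.bin c _ _
      rw [← hv, ← hv', O.bin_map]
  | graft a b ih ih' =>
    obtain ⟨e, he, hv⟩ := ih
    obtain ⟨e', he', hv'⟩ := ih'
    refine ⟨Equiv.sumCongr e e', ?_, ?_⟩
    · rintro (p | p)
      · exact he p
      · exact he' p
    · change O.map _ (O.bin d _ _) = O.bin d _ _
      rw [← hv, ← hv', O.bin_map]

end BTree

/-- Every element in the closure of the unit under `c` and `d` is the value of an expression in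
which each label occurs exactly once. -/
theorem SetOperad.Rep.exists_tree {O : SetOperad.{u}} {c d : O.obj (Fin 2)} {I : Type} [Finite I]
    {x : O.obj I} (hx : O.Rep c d I x) :
    ∃ (t : BTree I) (e : t.Pos ≃ I), (∀ p, e p = t.lab p) ∧ O.map e (t.eval O c d) = x := by
  induction hx with
  | one => exact ⟨.leaf (), Equiv.refl Unit, fun _ => rfl, O.map_refl _⟩
  | map f _ ih =>
    obtain ⟨t, e, he, hv⟩ := ih
    obtain ⟨g, hg, hgv⟩ := t.exists_equiv_map O c d f
    refine ⟨t.map f, (g.symm.trans e).trans f, fun p => ?_, ?_⟩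
    · rw [← g.apply_symm_apply p, hg]
      simp [he]
    · rw [← hgv, O.map_trans, O.map_trans, O.map_symm_map, hv]
  | left _ _ ih ih' =>
    obtain ⟨s, e, he, hv⟩ := ih
    obtain ⟨t, e', he', hv'⟩ := ih'
    obtain ⟨g, hg, hgv⟩ := s.exists_equiv_map O c d Sum.inl
    obtain ⟨g', hg', hgv'⟩ := t.exists_equiv_map O c d Sum.inr
    refine ⟨.union (s.map Sum.inl) (t.map Sum.inr),
      Equiv.sumCongr (g.symm.trans e) (g'.symm.trans e'), ?_, ?_⟩
    · rintro (p | p)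
      · change Sum.inl (e (g.symm p)) = (s.map Sum.inl).lab p
        rw [he, ← hg, g.apply_symm_apply]
      · change Sum.inr (e' (g'.symm p)) = (t.map Sum.inr).lab p
        rw [he', ← hg', g'.apply_symm_apply]
    · rw [BTree.eval, ← hgv, ← hgv', ← hv, ← hv']
      refine (O.bin_map _ _ _ _ _).symm.trans ?_
      rw [O.map_trans, O.map_trans, O.map_symm_map, O.map_symm_map]
  | right _ _ ih ih' =>
    obtain ⟨s, e, he, hv⟩ := ih
    obtain ⟨t, e', he', hv'⟩ := ih'
    obtain ⟨g, hg, hgv⟩ := s.exists_equiv_map O c d Sum.inl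
    obtain ⟨g', hg', hgv'⟩ := t.exists_equiv_map O c d Sum.inr
    refine ⟨.graft (s.map Sum.inl) (t.map Sum.inr),
      Equiv.sumCongr (g.symm.trans e) (g'.symm.trans e'), ?_, ?_⟩
    · rintro (p | p)
      · change Sum.inl (e (g.symm p)) = (s.map Sum.inl).lab p
        rw [he, ← hg, g.apply_symm_apply]
      · change Sum.inr (e' (g'.symm p)) = (t.map Sum.inr).lab p
        rw [he', ← hg', g'.apply_symm_apply]
    · rw [BTree.eval, ← hgv, ← hgv', ← hv, ← hv']
      refine (O.bin_map _ _ _ _ _).symm.trans ?_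
      rw [O.map_trans, O.map_trans, O.map_symm_map, O.map_symm_map]

/-! ### The shrub described by an expression -/

namespace BTree

variable {X : Type}

/-- The set of labels of an expression. -/
def supp : BTree X → Set X
  | leaf x => {x}
  | union a b => a.supp ∪ b.supp
  | graft a b => a.supp ∪ b.supp

/-- Each label occurs at most once. -/
def Nodup : BTree X → Prop
  | leaf _ => True
  | union a b => a.Nodup ∧ b.Nodup ∧ Disjoint a.supp b.supp
  | graft a b => a.Nodup ∧ b.Nodup ∧ Disjoint a.supp b.supp

/-- `t.HasHeight x n`: an occurrence of the label `x` has height `n` in the shrub described by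
the expression `t`. -/
def HasHeight : BTree X → X → ℕ → Prop
  | leaf x, y, n => y = x ∧ n = 0
  | union a b, y, n => a.HasHeight y n ∨ b.HasHeight y n
  | graft a b, y, n => a.HasHeight y n ∨ ∃ m, n = m + 1 ∧ b.HasHeight y m

/-- Adjacency in the shrub described by an expression. -/
def Adj : BTree X → X → X → Prop
  | leaf _, _, _ => False
  | union a b, x, y => a.Adj x y ∨ b.Adj x y
  | graft a b, x, y => a.Adj x y ∨ b.Adj x y ∨ (a.HasHeight x 0 ∧ b.HasHeight y 0) ∨
      (a.HasHeight y 0 ∧ b.HasHeight x 0)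

/-- The number of leaves. -/
def size : BTree X → ℕ
  | leaf _ => 1
  | union a b => a.size + b.size
  | graft a b => a.size + b.size

/-- The outermost operation is `union`. -/
def IsUnion : BTree X → Prop
  | union _ _ => True
  | _ => False

/-- The outermost operation is `graft`. -/
def IsGraft : BTree X → Prop
  | graft _ _ => True
  | _ => False

theorem size_pos : ∀ t : BTree X, 0 < t.size
  | leaf _ => Nat.one_pos
  | union a _ => Nat.add_pos_left a.size_pos _
  | graft a _ => Nat.add_pos_left a.size_pos _

theorem mem_supp_iff {t : BTree X} {x : X} : x ∈ t.supp ↔ ∃ n, t.HasHeight x n := by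
  induction t with
  | leaf y => simp [supp, HasHeight]
  | union a b iha ihb => simp [supp, HasHeight, iha, ihb, exists_or]
  | graft a b iha ihb =>
    simp only [supp, HasHeight, Set.mem_union, iha, ihb, exists_or]
    refine or_congr_right ⟨fun ⟨n, h⟩ => ⟨n + 1, n, rfl, h⟩, fun ⟨_, m, _, h⟩ => ⟨m, h⟩⟩

theorem HasHeight.mem_supp {t : BTree X} {x : X} {n : ℕ} (h : t.HasHeight x n) : x ∈ t.supp :=
  mem_supp_iff.2 ⟨n, h⟩

theorem Adj.symm {t : BTree X} {x y : X} (h : t.Adj x y) : t.Adj y x := by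
  induction t with
  | leaf y => exact h
  | union a b iha ihb => exact h.imp iha ihb
  | graft a b iha ihb =>
    rcases h with h | h | h | h
    · exact .inl (iha h)
    · exact .inr (.inl (ihb h))
    · exact .inr (.inr (.inr h))
    · exact .inr (.inr (.inl h))

theorem Adj.left_mem {t : BTree X} {x y : X} (h : t.Adj x y) : x ∈ t.supp := by
  induction t with
  | leaf y => exact h.elim
  | union a b iha ihb => exact h.imp iha ihb
  | graft a b iha ihb =>
    rcases h with h | h | h | h
    · exact .inl (iha h)
    · exact .inr (ihb h)
    · exact .inl h.1.mem_supp
    · exact .inr h.2.mem_supp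

theorem Adj.right_mem {t : BTree X} {x y : X} (h : t.Adj x y) : y ∈ t.supp := h.symm.left_mem

theorem exists_root : ∀ t : BTree X, ∃ x, t.HasHeight x 0
  | leaf x => ⟨x, rfl, rfl⟩
  | union a _ => a.exists_root.imp fun _ => .inl
  | graft a _ => a.exists_root.imp fun _ => .inl

theorem graft_hasHeight_zero {a b : BTree X} {x : X} :
    (graft a b).HasHeight x 0 ↔ a.HasHeight x 0 := by
  simp [HasHeight]

/-! ### Congruent expressions describe the same shrub -/

theorem Cong.hasHeight_iff {s t : BTree X} (h : s.Cong t) (x : X) (n : ℕ) :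
    s.HasHeight x n ↔ t.HasHeight x n := by
  induction h generalizing n with
  | refl a => rfl
  | symm _ ih => exact (ih n).symm
  | trans _ _ ih ih' => exact (ih n).trans (ih' n)
  | union _ _ ih ih' => simp only [HasHeight, ih, ih']
  | graft _ _ ih ih' => simp only [HasHeight, ih, ih']
  | union_comm a b => exact or_comm
  | union_assoc a b c => exact or_assoc
  | graft_graft a b c =>
    simp only [HasHeight, or_assoc]
    exact or_congr_right (by simp only [← exists_or, ← and_or_left])

theorem Cong.adj_iff {s t : BTree X} (h : s.Cong t) (x y : X) : s.Adj x y ↔ t.Adj x y := by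
  induction h with
  | refl a => rfl
  | symm _ ih => exact ih.symm
  | trans _ _ ih ih' => exact ih.trans ih'
  | union _ _ ih ih' => simp only [Adj, ih, ih']
  | graft h h' ih ih' => simp only [Adj, ih, ih', h.hasHeight_iff, h'.hasHeight_iff]
  | union_comm a b => exact or_comm
  | union_assoc a b c => exact or_assoc
  | graft_graft a b c =>
    simp only [Adj, HasHeight]
    tauto

theorem Cong.supp_eq {s t : BTree X} (h : s.Cong t) : s.supp = t.supp := by
  ext x
  simp only [mem_supp_iff, h.hasHeight_iff]

theorem Cong.nodup_iff {s t : BTree X} (h : s.Cong t) : s.Nodup ↔ t.Nodup := by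
  induction h with
  | refl a => rfl
  | symm _ ih => exact ih.symm
  | trans _ _ ih ih' => exact ih.trans ih'
  | union h h' ih ih' => simp only [Nodup, ih, ih', h.supp_eq, h'.supp_eq]
  | graft h h' ih ih' => simp only [Nodup, ih, ih', h.supp_eq, h'.supp_eq]
  | union_comm a b => simp only [Nodup, disjoint_comm (a := a.supp)]; tauto
  | union_assoc a b c =>
    simp only [Nodup, supp, Set.disjoint_union_left, Set.disjoint_union_right]; tauto
  | graft_graft a b c =>
    simp only [Nodup, supp, Set.disjoint_union_left, Set.disjoint_union_right]; tauto

/-! ### Connectedness -/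

/-- Every vertex is connected to a vertex of height zero. -/
theorem exists_reflTransGen_root (t : BTree X) {x : X} (hx : x ∈ t.supp) :
    ∃ r, t.HasHeight r 0 ∧ Relation.ReflTransGen t.Adj x r := by
  induction t with
  | leaf y => exact ⟨x, ⟨hx, rfl⟩, .refl⟩
  | union a b iha ihb =>
    rcases hx with hx | hx
    · obtain ⟨r, hr, h⟩ := iha hx
      exact ⟨r, .inl hr, Relation.ReflTransGen.mono (fun _ _ => .inl) _ _ h⟩
    · obtain ⟨r, hr, h⟩ := ihb hx
      exact ⟨r, .inr hr, Relation.ReflTransGen.mono (fun _ _ => .inr) _ _ h⟩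
  | graft a b iha ihb =>
    rcases hx with hx | hx
    · obtain ⟨r, hr, h⟩ := iha hx
      exact ⟨r, .inl hr, Relation.ReflTransGen.mono (fun _ _ => .inl) _ _ h⟩
    · obtain ⟨r, hr, h⟩ := ihb hx
      obtain ⟨q, hq⟩ := a.exists_root
      exact ⟨q, .inl hq, .tail
        (Relation.ReflTransGen.mono (fun _ _ h => .inr (.inl h)) _ _ h)
        (.inr (.inr (.inr ⟨hq, hr⟩)))⟩

/-- An expression whose outermost operation is not `union` describes a connected graph. -/
theorem reflTransGen_adj {t : BTree X} (ht : ¬ t.IsUnion) {x y : X} (hx : x ∈ t.supp)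
    (hy : y ∈ t.supp) : Relation.ReflTransGen t.Adj x y := by
  cases t with
  | leaf z =>
    obtain rfl : x = z := hx
    obtain rfl : y = x := hy
    exact .refl
  | union a b => exact (ht trivial).elim
  | graft a b =>
    obtain ⟨r, hr, hxr⟩ := exists_reflTransGen_root _ hx
    obtain ⟨q, hq, hyq⟩ := exists_reflTransGen_root _ hy
    obtain ⟨z, hz⟩ := b.exists_root
    rw [graft_hasHeight_zero] at hr hq
    have hqy : Relation.ReflTransGen (graft a b).Adj q y :=
      have : Std.Symm (graft a b).Adj := ⟨fun _ _ => Adj.symm⟩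
      symm hyq
    exact (hxr.tail (.inr (.inr (.inl ⟨hr, hz⟩)))).trans
      (.head (.inr (.inr (.inr ⟨hq, hz⟩))) hqy)

/-- There are no edges between the two parts of a `union`. -/
theorem mem_supp_of_reflTransGen_union {a b : BTree X} (h : (union a b).Nodup) {x y : X}
    (hxy : Relation.ReflTransGen (union a b).Adj x y) (hx : x ∈ a.supp) : y ∈ a.supp := by
  induction hxy with
  | refl => exact hx
  | tail _ hyz ih =>
    rcases hyz with hyz | hyz
    · exact hyz.right_mem
    · exact (Set.disjoint_left.1 h.2.2 ih hyz.left_mem).elim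

/-! ### Normal forms -/

/-- An iterated graft can be rewritten so that its first factor is not a graft. -/
theorem exists_cong_graft (a b : BTree X) : ∃ a' b', (graft a b).Cong (graft a' b') ∧
    ¬ a'.IsGraft ∧ a'.size + b'.size = a.size + b.size := by
  induction a generalizing b with
  | leaf x => exact ⟨_, _, .refl _, id, rfl⟩
  | union a₁ a₂ => exact ⟨_, _, .refl _, id, rfl⟩
  | graft a₁ a₂ ih _ =>
    obtain ⟨a', b', h, hg, hs⟩ := ih (union a₂ b)
    exact ⟨a', b', .trans (.graft_graft _ _ _) h, hg, by simp only [size] at hs ⊢; omega⟩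

/-- An iterated union can be rewritten so that its first factor is the connected component of a
given vertex. -/
theorem exists_cong_union {a b : BTree X} {v : X} (hv : v ∈ (union a b).supp) :
    ∃ a' b', (union a b).Cong (union a' b') ∧
      ¬ a'.IsUnion ∧ v ∈ a'.supp ∧ a'.size + b'.size = a.size + b.size := by
  have key : ∀ a b : BTree X, v ∈ a.supp → ∃ a' b', (union a b).Cong (union a' b') ∧
      ¬ a'.IsUnion ∧ v ∈ a'.supp ∧ a'.size + b'.size = a.size + b.size := by
    clear hv a b
    intro a b hv
    induction a generalizing b with
    | leaf x => exact ⟨_, _, .refl _, id, hv, rfl⟩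
    | graft a₁ a₂ => exact ⟨_, _, .refl _, id, hv, rfl⟩
    | union a₁ a₂ ih ih' =>
      rcases hv with hv | hv
      · obtain ⟨a', b', h, hu, hm, hs⟩ := ih (union a₂ b) hv
        exact ⟨a', b', .trans (.union_assoc _ _ _) h, hu, hm, by
          simp only [size] at hs ⊢; omega⟩
      · obtain ⟨a', b', h, hu, hm, hs⟩ := ih' (union a₁ b) hv
        exact ⟨a', b', .trans (.union (.union_comm _ _) (.refl _))
          (.trans (.union_assoc _ _ _) h), hu, hm, by simp only [size] at hs ⊢; omega⟩
  rcases hv with hv | hv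
  · exact key a b hv
  · obtain ⟨a', b', h, hu, hm, hs⟩ := key b a hv
    exact ⟨a', b', .trans (.union_comm _ _) h, hu, hm, by omega⟩

/-! ### Expressions that describe the same shrub are congruent -/

/-- Two expressions describe the same graph with the same heights. -/
structure SameShrub (s t : BTree X) : Prop where
  height : ∀ x n, s.HasHeight x n ↔ t.HasHeight x n
  adj : ∀ x y, s.Adj x y ↔ t.Adj x y

theorem Cong.sameShrub {s t : BTree X} (h : s.Cong t) : s.SameShrub t :=
  ⟨h.hasHeight_iff, h.adj_iff⟩

namespace SameShrub

theorem symm {s t : BTree X} (h : s.SameShrub t) : t.SameShrub s :=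
  ⟨fun x n => (h.height x n).symm, fun x y => (h.adj x y).symm⟩

theorem trans {s t r : BTree X} (h : s.SameShrub t) (h' : t.SameShrub r) : s.SameShrub r :=
  ⟨fun x n => (h.height x n).trans (h'.height x n), fun x y => (h.adj x y).trans (h'.adj x y)⟩

theorem supp_eq {s t : BTree X} (h : s.SameShrub t) : s.supp = t.supp := by
  ext x
  simp only [mem_supp_iff, h.height]

end SameShrub

section union

variable {a b a' b' : BTree X}

theorem union_hasHeight_left (h : (union a b).Nodup) {x : X} {n : ℕ} :
    a.HasHeight x n ↔ (union a b).HasHeight x n ∧ x ∈ a.supp :=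
  ⟨fun hx => ⟨.inl hx, hx.mem_supp⟩, fun ⟨hx, hm⟩ =>
    hx.resolve_right fun hb => Set.disjoint_left.1 h.2.2 hm hb.mem_supp⟩

theorem union_adj_left (h : (union a b).Nodup) {x y : X} :
    a.Adj x y ↔ (union a b).Adj x y ∧ x ∈ a.supp :=
  ⟨fun hx => ⟨.inl hx, hx.left_mem⟩, fun ⟨hx, hm⟩ =>
    hx.resolve_right fun hb => Set.disjoint_left.1 h.2.2 hm hb.left_mem⟩

theorem union_supp_right (h : (union a b).Nodup) : b.supp = (union a b).supp \ a.supp :=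
  (Set.union_sdiff_cancel_left (Set.disjoint_iff.1 h.2.2)).symm

theorem nodup_union_comm : (union a b).Nodup ↔ (union b a).Nodup := (Cong.union_comm a b).nodup_iff

theorem SameShrub.union_left (hn : (union a b).Nodup) (hn' : (union a' b').Nodup)
    (h : (union a b).SameShrub (union a' b')) (hs : a.supp = a'.supp) : a.SameShrub a' :=
  ⟨fun x n => by rw [union_hasHeight_left hn, union_hasHeight_left hn', h.height, hs],
    fun x y => by rw [union_adj_left hn, union_adj_left hn', h.adj, hs]⟩

theorem SameShrub.union_right (hn : (union a b).Nodup) (hn' : (union a' b').Nodup)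
    (h : (union a b).SameShrub (union a' b')) (hs : a.supp = a'.supp) : b.SameShrub b' :=
  .union_left (nodup_union_comm.1 hn) (nodup_union_comm.1 hn')
    ((Cong.union_comm b a).sameShrub.trans (h.trans (Cong.union_comm a' b').sameShrub))
    (by rw [union_supp_right hn, union_supp_right hn', h.supp_eq, hs])

/-- In two descriptions `a ∪ b` and `a' ∪ b'` of one shrub, if `a` is connected then it is contained
in the part `a'` that it meets. -/
theorem SameShrub.supp_subset_of_union (hn' : (union a' b').Nodup)
    (h : (union a b).SameShrub (union a' b')) (ha : ¬ a.IsUnion) {v : X} (hv : v ∈ a.supp)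
    (hv' : v ∈ a'.supp) : a.supp ⊆ a'.supp := fun _ hx =>
  mem_supp_of_reflTransGen_union hn'
    (Relation.ReflTransGen.mono (fun y z hyz => (h.adj y z).1 (.inl hyz)) _ _
      (reflTransGen_adj ha hv hx)) hv'

/-- A graph described by a `union` is not connected. -/
theorem not_sameShrub_union (hn : (union a b).Nodup) {t : BTree X} (ht : ¬ t.IsUnion) :
    ¬ (union a b).SameShrub t := fun h => by
  obtain ⟨x, hx⟩ := a.exists_root
  obtain ⟨y, hy⟩ := b.exists_root
  have hxy := reflTransGen_adj ht (x := x) (y := y) (h.supp_eq ▸ .inl hx.mem_supp)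
    (h.supp_eq ▸ .inr hy.mem_supp)
  exact Set.disjoint_left.1 hn.2.2 (mem_supp_of_reflTransGen_union hn
    (Relation.ReflTransGen.mono (fun u v => (h.adj u v).2) _ _ hxy) hx.mem_supp) hy.mem_supp

end union

section graft

variable {a b a' b' : BTree X}

theorem graft_hasHeight_left (h : (graft a b).Nodup) {x : X} {n : ℕ} :
    a.HasHeight x n ↔ (graft a b).HasHeight x n ∧ x ∈ a.supp :=
  ⟨fun hx => ⟨.inl hx, hx.mem_supp⟩, fun ⟨hx, hm⟩ =>
    hx.resolve_right fun ⟨_, _, hb⟩ => Set.disjoint_left.1 h.2.2 hm hb.mem_supp⟩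

theorem graft_hasHeight_right (h : (graft a b).Nodup) {x : X} {n : ℕ} :
    b.HasHeight x n ↔ (graft a b).HasHeight x (n + 1) ∧ x ∈ b.supp := by
  refine ⟨fun hx => ⟨.inr ⟨n, rfl, hx⟩, hx.mem_supp⟩, fun ⟨hx, hm⟩ => ?_⟩
  rcases hx with hx | ⟨m, hnm, hx⟩
  · exact (Set.disjoint_left.1 h.2.2 hx.mem_supp hm).elim
  · obtain rfl : n = m := by omega
    exact hx

theorem graft_adj_left (h : (graft a b).Nodup) {x y : X} :
    a.Adj x y ↔ (graft a b).Adj x y ∧ x ∈ a.supp ∧ y ∈ a.supp := by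
  refine ⟨fun hx => ⟨.inl hx, hx.left_mem, hx.right_mem⟩, fun ⟨hx, hm, hm'⟩ => ?_⟩
  have hd := Set.disjoint_left.1 h.2.2
  rcases hx with hx | hx | hx | hx
  · exact hx
  · exact (hd hm hx.left_mem).elim
  · exact (hd hm' hx.2.mem_supp).elim
  · exact (hd hm hx.2.mem_supp).elim

theorem graft_adj_right (h : (graft a b).Nodup) {x y : X} :
    b.Adj x y ↔ (graft a b).Adj x y ∧ x ∈ b.supp ∧ y ∈ b.supp := by
  refine ⟨fun hx => ⟨.inr (.inl hx), hx.left_mem, hx.right_mem⟩, fun ⟨hx, hm, hm'⟩ => ?_⟩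
  have hd := Set.disjoint_right.1 h.2.2
  rcases hx with hx | hx | hx | hx
  · exact (hd hm hx.left_mem).elim
  · exact hx
  · exact (hd hm hx.1.mem_supp).elim
  · exact (hd hm' hx.1.mem_supp).elim

theorem graft_supp_left (h : (graft a b).Nodup) : a.supp = (graft a b).supp \ b.supp :=
  (Set.union_sdiff_cancel_right (Set.disjoint_iff.1 h.2.2)).symm

/-- In two descriptions `a ◁ b` and `a' ◁ b'` of one shrub, where `a'` is not itself a graft, the
set of vertices of `b` is contained in that of `b'`. Otherwise `a'` is a disjoint union, some
path in `b` ends at a root of `b` inside one part of `a'`, and this root of `b` is adjacent to the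
roots of the other part. -/
theorem SameShrub.supp_subset_of_graft (hn : (graft a b).Nodup) (hn' : (graft a' b').Nodup)
    (h : (graft a b).SameShrub (graft a' b')) (ha' : ¬ a'.IsGraft) : b.supp ⊆ b'.supp := by
  intro y hy
  have hd := Set.disjoint_left.1 hn.2.2
  have hd' := Set.disjoint_left.1 hn'.2.2
  have hroot : ∀ x, a'.HasHeight x 0 ↔ a.HasHeight x 0 := fun x => by
    rw [← graft_hasHeight_zero (b := b'), ← h.height, graft_hasHeight_zero]
  by_contra hyb
  have hya : y ∈ a'.supp :=
    (show y ∈ (graft a' b').supp from h.supp_eq ▸ .inr hy).resolve_right hyb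
  obtain ⟨r, hr, hyr⟩ := b.exists_reflTransGen_root hy
  -- the edges of the shrub at a vertex of `b` that lies in `a'` stay in `a'`
  have hstep : ∀ u w, b.Adj u w → u ∈ a'.supp → a'.Adj u w := by
    intro u w huw hu
    have := (h.adj u w).1 (.inr (.inl huw))
    rcases this with h1 | h1 | h1 | h1
    · exact h1
    · exact (hd' hu h1.left_mem).elim
    · exact (hd ((hroot u).1 h1.1).mem_supp huw.left_mem).elim
    · exact (hd' hu h1.2.mem_supp).elim
  cases a' with
  | leaf z =>
    obtain rfl : y = z := hya
    exact hd ((hroot y).1 ⟨rfl, rfl⟩).mem_supp hy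
  | graft c d => exact ha' trivial
  | union c d =>
    have hry : Relation.ReflTransGen (union c d).Adj y r ∧ r ∈ (union c d).supp := by
      clear hr
      induction hyr with
      | refl => exact ⟨.refl, hya⟩
      | tail _ huw ih =>
        have := hstep _ _ huw ih.2
        exact ⟨ih.1.tail this, this.right_mem⟩
    -- a root of `a'` is adjacent to the root `r` of `b`, and this edge lies in `a'`
    have hedge : ∀ q, (union c d).HasHeight q 0 → (union c d).Adj q r := by
      intro q hq
      have := (h.adj q r).1 (.inr (.inr (.inl ⟨(hroot q).1 hq, hr⟩)))
      rcases this with h1 | h1 | h1 | h1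
      · exact h1
      · exact (hd' hq.mem_supp h1.left_mem).elim
      · exact (hd' hry.2 h1.2.mem_supp).elim
      · exact (hd ((hroot r).1 h1.1).mem_supp hr.mem_supp).elim
    obtain ⟨q, hq⟩ := c.exists_root
    obtain ⟨q', hq'⟩ := d.exists_root
    have hqq' : Relation.ReflTransGen (union c d).Adj q q' :=
      .tail (.single (hedge q (.inl hq))) (hedge q' (.inr hq')).symm
    exact Set.disjoint_left.1 hn'.1.2.2
      (mem_supp_of_reflTransGen_union hn'.1 hqq' hq.mem_supp) hq'.mem_supp

theorem SameShrub.graft_left (hn : (graft a b).Nodup) (hn' : (graft a' b').Nodup)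
    (h : (graft a b).SameShrub (graft a' b')) (hs : b.supp = b'.supp) : a.SameShrub a' := by
  have hs' : a.supp = a'.supp := by rw [graft_supp_left hn, graft_supp_left hn', h.supp_eq, hs]
  exact ⟨fun x n => by rw [graft_hasHeight_left hn, graft_hasHeight_left hn', h.height, hs'],
    fun x y => by rw [graft_adj_left hn, graft_adj_left hn', h.adj, hs']⟩

theorem SameShrub.graft_right (hn : (graft a b).Nodup) (hn' : (graft a' b').Nodup)
    (h : (graft a b).SameShrub (graft a' b')) (hs : b.supp = b'.supp) : b.SameShrub b' :=
  ⟨fun x n => by rw [graft_hasHeight_right hn, graft_hasHeight_right hn', h.height, hs],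
    fun x y => by rw [graft_adj_right hn, graft_adj_right hn', h.adj, hs]⟩

end graft

theorem eq_leaf_of_supp_eq {t : BTree X} (hn : t.Nodup) {x : X} (h : t.supp = {x}) :
    t = leaf x := by
  have key : ∀ a b : BTree X, Disjoint a.supp b.supp → a.supp ∪ b.supp ≠ {x} := by
    intro a b hd hab
    obtain ⟨y, hy⟩ := a.exists_root
    obtain ⟨z, hz⟩ := b.exists_root
    have hy' : y = x := hab.subset (.inl hy.mem_supp)
    have hz' : z = x := hab.subset (.inr hz.mem_supp)
    exact Set.disjoint_left.1 hd hy.mem_supp (hy'.trans hz'.symm ▸ hz.mem_supp)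
  cases t with
  | leaf y => rw [Set.singleton_injective h]
  | union a b => exact (key a b hn.2.2 h).elim
  | graft a b => exact (key a b hn.2.2 h).elim

/-- Expressions without repeated labels that describe the same shrub are congruent. -/
theorem SameShrub.cong {s t : BTree X} (hs : s.Nodup) (ht : t.Nodup) (h : s.SameShrub t) :
    s.Cong t := by
  obtain ⟨n, hn⟩ : ∃ n, s.size = n := ⟨_, rfl⟩
  induction n using Nat.strong_induction_on generalizing s t with
  | _ n ih =>
  subst hn
  cases s with
  | leaf x => rw [eq_leaf_of_supp_eq ht h.supp_eq.symm]; exact .refl _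
  | union a b =>
    cases t with
    | leaf x => exact (not_sameShrub_union hs id h).elim
    | graft a' b' => exact (not_sameShrub_union hs id h).elim
    | union a' b' =>
      obtain ⟨v, hv⟩ := (union a b).exists_root
      obtain ⟨p, q, hpq, hp, hvp, hsize⟩ := exists_cong_union hv.mem_supp
      obtain ⟨p', q', hpq', hp', hvp', -⟩ := exists_cong_union (h.supp_eq ▸ hv.mem_supp)
      have hn := hpq.nodup_iff.1 hs
      have hn' := hpq'.nodup_iff.1 ht
      have h' := hpq.sameShrub.symm.trans (h.trans hpq'.sameShrub)
      have hsupp : p.supp = p'.supp := (h'.supp_subset_of_union hn' hp hvp hvp').antisymm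
        (h'.symm.supp_subset_of_union hn hp' hvp' hvp)
      have := p.size_pos
      have := q.size_pos
      exact .trans hpq (.trans (.union
        (ih p.size (by simp only [size]; omega) hn.1 hn'.1 (h'.union_left hn hn' hsupp) rfl)
        (ih q.size (by simp only [size]; omega) hn.2.1 hn'.2.1 (h'.union_right hn hn' hsupp) rfl))
        hpq'.symm)
  | graft a b =>
    cases t with
    | leaf x => rw [eq_leaf_of_supp_eq hs h.supp_eq]; exact .refl _
    | union a' b' => exact (not_sameShrub_union ht id h.symm).elim
    | graft a' b' =>
      obtain ⟨p, q, hpq, hp, hsize⟩ := exists_cong_graft a b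
      obtain ⟨p', q', hpq', hp', -⟩ := exists_cong_graft a' b'
      have hn := hpq.nodup_iff.1 hs
      have hn' := hpq'.nodup_iff.1 ht
      have h' := hpq.sameShrub.symm.trans (h.trans hpq'.sameShrub)
      have hsupp : q.supp = q'.supp := (h'.supp_subset_of_graft hn hn' hp').antisymm
        (h'.symm.supp_subset_of_graft hn' hn hp)
      have := p.size_pos
      have := q.size_pos
      exact .trans hpq (.trans (.graft
        (ih p.size (by simp only [size]; omega) hn.1 hn'.1 (h'.graft_left hn hn' hsupp) rfl)
        (ih q.size (by simp only [size]; omega) hn.2.1 hn'.2.1 (h'.graft_right hn hn' hsupp) rfl))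
        hpq'.symm)

end BTree

/-! ### Decomposition of shrubs -/

namespace Shrub

variable {I : Type} (P : Shrub I)

/-- A non-empty set `S` of vertices such that the induced graph, with heights lowered by `k`, is
again a shrub. The conditions on edges and on forbidden subgraphs are inherited from `P`. -/
structure IsPiece (k : ℕ) (S : Set I) : Prop where
  nonempty : S.Nonempty
  le_height : ∀ x ∈ S, k ≤ P.height x
  exists_below : ∀ x ∈ S, k < P.height x → ∃ y ∈ S, P.graph.Adj x y ∧ P.height x = P.height y + 1

/-- The neighbours in `S` just below a vertex. -/
def lower (S : Set I) (x : I) : Set I :=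
  {y | y ∈ S ∧ P.graph.Adj x y ∧ P.height x = P.height y + 1}

/-- The vertices reached from `x` by `n + 1` downward steps in `S`. -/
def descend (S : Set I) : ℕ → I → Set I
  | 0, x => P.lower S x
  | n + 1, x => ⋃ y ∈ P.lower S x, descend S n y

/-- For a vertex `x` of height greater than `k`, the vertices of height `k` below `x`. -/
def roots (k : ℕ) (S : Set I) (x : I) : Set I :=
  P.descend S (P.height x - k - 1) x

variable {P} {k : ℕ} {S : Set I}

theorem lower_subset_lower {x y z : I} (hy : y ∈ P.lower S x) (hz : z ∈ P.lower S x) :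
    P.lower S y ⊆ P.lower S z := by
  rintro w ⟨hw, hyw, hh⟩
  refine ⟨hw, ?_, by have := hy.2.2; have := hz.2.2; omega⟩
  by_contra hzw
  exact P.no_four x y z w (by have := hy.2.2; omega) hh (by have := hy.2.2; have := hz.2.2; omega)
    ⟨hy.2.1, hz.2.1, hyw, hzw⟩

theorem lower_eq_lower {x y z : I} (hy : y ∈ P.lower S x) (hz : z ∈ P.lower S x) :
    P.lower S y = P.lower S z :=
  (lower_subset_lower hy hz).antisymm (lower_subset_lower hz hy)

theorem descend_congr {y z : I} (h : P.lower S y = P.lower S z) (n : ℕ) :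
    P.descend S n y = P.descend S n z := by
  cases n with
  | zero => exact h
  | succ n => simp only [descend, h]

/-- By the second forbidden configuration, all the vertices just below `x` have the same
vertices below them. -/
theorem roots_eq_of_mem_lower {x y : I} (hy : y ∈ P.lower S x) (hk : k < P.height y) :
    P.roots k S x = P.roots k S y := by
  have hx := hy.2.2
  rw [roots, show P.height x - k - 1 = (P.height y - k - 1) + 1 by omega, descend]
  ext r
  simp only [Set.mem_iUnion]
  constructor
  · rintro ⟨z, hz, hr⟩
    rw [roots]
    rwa [← descend_congr (lower_eq_lower hz hy)]
  · exact fun hr => ⟨y, hy, hr⟩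

theorem roots_eq_of_adj {x y : I} (hx : x ∈ S) (hy : y ∈ S) (hxy : P.graph.Adj x y)
    (hkx : k < P.height x) (hky : k < P.height y) : P.roots k S x = P.roots k S y := by
  rcases P.height_adj x y hxy with h | h
  · exact roots_eq_of_mem_lower ⟨hy, hxy, h⟩ hky
  · exact (roots_eq_of_mem_lower ⟨hx, hxy.symm, h⟩ hkx).symm

theorem roots_eq_lower {x : I} (hx : P.height x = k + 1) : P.roots k S x = P.lower S x := by
  rw [roots, show P.height x - k - 1 = 0 by omega, descend]

/-- By the first forbidden configuration, the sets of roots below two vertices of height one are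
disjoint or comparable. -/
theorem lower_subset_or_subset {x y r : I} (hx : r ∈ P.lower S x) (hy : r ∈ P.lower S y) :
    P.lower S x ⊆ P.lower S y ∨ P.lower S y ⊆ P.lower S x := by
  by_contra! h
  obtain ⟨⟨c, hc, hc'⟩, ⟨e, he, he'⟩⟩ := Set.not_subset.1 h.1, Set.not_subset.1 h.2
  have h1 := hx.2.2
  have h2 := hy.2.2
  have h3 := hc.2.2
  have h4 := he.2.2
  exact P.no_five x y c r e h3 (by omega) (by omega) (by omega)
    ⟨hc.2.1, hx.2.1, hy.2.1, he.2.1, fun h => he' ⟨he.1, h, by omega⟩,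
      fun h => hc' ⟨hc.1, h, by omega⟩⟩

/-- A connected shrub with more than one vertex has a vertex of height one that is adjacent to all
the vertices of height zero. -/
theorem IsPiece.exists_adj_roots (hS : P.IsPiece k S) (hfin : S.Finite) (hnt : S.Nontrivial)
    (hconn : ∀ A ⊆ S, A.Nonempty → (∀ x ∈ A, ∀ y ∈ S, P.graph.Adj x y → y ∈ A) → A = S) :
    ∃ a ∈ S, P.height a = k + 1 ∧ ∀ r ∈ S, P.height r = k → r ∈ P.lower S a := by
  have hone : {a | a ∈ S ∧ P.height a = k + 1}.Nonempty := by
    obtain ⟨v, hv, hkv⟩ : ∃ v ∈ S, k < P.height v := by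
      by_contra! h
      obtain ⟨x, hx⟩ := hS.nonempty
      refine hnt.not_subset_singleton (x := x) (hconn {x} (by simpa) (by simp) ?_).ge
      rintro y rfl z hz hyz
      have := h y hx
      have := h z hz
      have := hS.le_height y hx
      have := hS.le_height z hz
      rcases P.height_adj y z hyz with h | h <;> omega
    obtain ⟨n, hn⟩ : ∃ n, P.height v = k + 1 + n := ⟨P.height v - k - 1, by omega⟩
    induction n generalizing v with
    | zero => exact ⟨v, hv, hn⟩
    | succ n ih =>
      obtain ⟨w, hw, -, hvw⟩ := hS.exists_below v hv hkv
      exact ih w hw (by omega) (by omega)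
  obtain ⟨a, ha, hmax⟩ := (hfin.subset fun _ h => h.1).exists_maximalFor (P.lower S) _ hone
  refine ⟨a, ha.1, ha.2, fun r hr hrk => ?_⟩
  -- the vertices that lie above or among the roots below `a` form a union of components
  let A : Set I := {v | v ∈ S ∧ ((P.height v = k ∧ v ∈ P.lower S a) ∨
    (k < P.height v ∧ P.roots k S v ⊆ P.lower S a))}
  have hA : A = S := by
    refine hconn A (fun _ h => h.1)
      ⟨a, ha.1, .inr ⟨by have := ha.2; omega, (roots_eq_lower ha.2).subset⟩⟩ ?_
    rintro x ⟨hx, ⟨hxk, hxa⟩ | ⟨hxk, hxa⟩⟩ y hy hxy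
    · have hyk : P.height y = k + 1 := by
        have := hS.le_height y hy
        rcases P.height_adj x y hxy with h | h <;> omega
      refine ⟨hy, .inr ⟨by omega, ?_⟩⟩
      rw [roots_eq_lower hyk]
      rcases lower_subset_or_subset hxa (y := y) ⟨hx, hxy.symm, by omega⟩ with h | h
      · exact hmax ⟨hy, hyk⟩ h
      · exact h
    · rcases (hS.le_height y hy).eq_or_lt with hyk | hyk
      · have hx1 : P.height x = k + 1 := by
          rcases P.height_adj x y hxy with h | h <;> omega
        rw [roots_eq_lower hx1] at hxa
        exact ⟨hy, .inl ⟨hyk.symm, hxa ⟨hy, hxy, by omega⟩⟩⟩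
      · exact ⟨hy, .inr ⟨hyk, roots_eq_of_adj hx hy hxy hxk hyk ▸ hxa⟩⟩
  rcases (hA ▸ hr : r ∈ A).2 with h | h
  · exact h.2
  · omega

/-- A connected shrub with more than one vertex is a graft: the part put on top is the connected
component of a suitable vertex of height one in the graph of the vertices of positive height. -/
theorem IsPiece.exists_graft (hS : P.IsPiece k S) (hfin : S.Finite) (hnt : S.Nontrivial)
    (hconn : ∀ A ⊆ S, A.Nonempty → (∀ x ∈ A, ∀ y ∈ S, P.graph.Adj x y → y ∈ A) → A = S) :
    ∃ T ⊆ S, P.IsPiece k (S \ T) ∧ P.IsPiece (k + 1) T ∧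
      ∀ x ∈ S \ T, ∀ y ∈ T, P.graph.Adj x y ↔ P.height x = k ∧ P.height y = k + 1 := by
  obtain ⟨a, ha, hak, hroot⟩ := hS.exists_adj_roots hfin hnt hconn
  let T : Set I :=
    {v | Relation.ReflTransGen (fun x y => P.graph.Adj x y ∧ y ∈ S ∧ k < P.height y) a v}
  have hT : ∀ v ∈ T, v ∈ S ∧ k < P.height v ∧ P.roots k S v = P.lower S a := by
    intro v hv
    induction hv with
    | refl => exact ⟨ha, by omega, roots_eq_lower hak⟩
    | tail _ h ih =>
      exact ⟨h.2.1, h.2.2, by rw [← ih.2.2, roots_eq_of_adj ih.1 h.2.1 h.1 ih.2.1 h.2.2]⟩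
  have hstep : ∀ x ∈ T, ∀ y ∈ S, P.graph.Adj x y → k < P.height y → y ∈ T :=
    fun x hx y hy hxy hk => Relation.ReflTransGen.tail hx ⟨hxy, hy, hk⟩
  refine ⟨T, fun v hv => (hT v hv).1, ⟨?_, fun x hx => hS.le_height x hx.1, ?_⟩,
    ⟨⟨a, .refl⟩, fun x hx => (hT x hx).2.1, ?_⟩, ?_⟩
  · obtain ⟨r, hr, -, har⟩ := hS.exists_below a ha (by omega)
    exact ⟨r, hr, fun h => by have := (hT r h).2.1; omega⟩
  · rintro x ⟨hx, hxT⟩ hk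
    obtain ⟨y, hy, hxy, hh⟩ := hS.exists_below x hx hk
    exact ⟨y, ⟨hy, fun hyT => hxT (hstep y hyT x hx hxy.symm hk)⟩, hxy, hh⟩
  · intro x hx hk
    obtain ⟨y, hy, hxy, hh⟩ := hS.exists_below x (hT x hx).1 (by omega)
    exact ⟨y, hstep x hx y hy hxy (by omega), hxy, hh⟩
  · rintro x ⟨hx, hxT⟩ y hy
    obtain ⟨hyS, hyk, hyr⟩ := hT y hy
    constructor
    · intro hxy
      have hxk : P.height x = k := by
        by_contra hne
        have := hS.le_height x hx
        exact hxT (hstep y hy x hx hxy.symm (by omega))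
      refine ⟨hxk, ?_⟩
      rcases P.height_adj x y hxy with h | h <;> omega
    · rintro ⟨hxk, hyk1⟩
      rw [roots_eq_lower hyk1] at hyr
      have := hroot x hx hxk
      rw [← hyr] at this
      exact this.2.1.symm

/-- Every shrub is described by an expression: a disconnected one by a union, a connected one with
more than one vertex by a graft. -/
theorem IsPiece.exists_tree (hfin : S.Finite) (hS : P.IsPiece k S) :
    ∃ t : BTree I, t.Nodup ∧ (∀ x n, t.HasHeight x n ↔ x ∈ S ∧ P.height x = n + k) ∧
      ∀ x y, t.Adj x y ↔ x ∈ S ∧ y ∈ S ∧ P.graph.Adj x y := by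
  induction hn : S.ncard using Nat.strong_induction_on generalizing S k with
  | _ n ih =>
  subst hn
  have hsupp : ∀ {t : BTree I} {A : Set I} {l : ℕ}, P.IsPiece l A →
      (∀ x n, t.HasHeight x n ↔ x ∈ A ∧ P.height x = n + l) → t.supp = A := by
    intro t A l hA h
    ext x
    simp only [BTree.mem_supp_iff, h, exists_and_left]
    refine and_iff_left_of_imp fun hx => ⟨P.height x - l, ?_⟩
    have := hA.le_height x hx
    omega
  by_cases hconn : ∀ A ⊆ S, A.Nonempty → (∀ x ∈ A, ∀ y ∈ S, P.graph.Adj x y → y ∈ A) → A = S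
  · rcases S.subsingleton_or_nontrivial with hsub | hnt
    · obtain ⟨x, rfl⟩ :=
        Set.exists_eq_singleton_iff_nonempty_subsingleton.2 ⟨hS.nonempty, hsub⟩
      have hx : P.height x = k := by
        by_contra hne
        have := hS.le_height x rfl
        obtain ⟨y, rfl, hxy, -⟩ := hS.exists_below x rfl (by omega)
        exact hxy.ne rfl
      refine ⟨.leaf x, trivial, fun y n => ?_, fun y z => ?_⟩
      · simp only [BTree.HasHeight, Set.mem_singleton_iff]
        refine and_congr_right ?_
        rintro rfl
        omega
      · simp only [BTree.Adj, Set.mem_singleton_iff, false_iff]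
        rintro ⟨rfl, rfl, h⟩
        exact h.ne rfl
    · obtain ⟨T, hTS, hB, hT, hBT⟩ := hS.exists_graft hfin hnt hconn
      obtain ⟨s, hs, hsh, hsa⟩ := ih (S \ T).ncard (Set.ncard_lt_ncard
        (Set.sdiff_ssubset_left_iff.2 (by rw [Set.inter_eq_right.2 hTS]; exact hT.nonempty)) hfin)
        (hfin.subset Set.sdiff_subset) hB rfl
      obtain ⟨t, ht, hth, hta⟩ := ih T.ncard (Set.ncard_lt_ncard (by
        refine hTS.ssubset_of_ne ?_
        rintro rfl
        simpa using hB.nonempty) hfin) (hfin.subset hTS) hT rfl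
      refine ⟨.graft s t, ⟨hs, ht, ?_⟩, fun x n => ?_, fun x y => ?_⟩
      · rw [hsupp hB hsh, hsupp hT hth]
        exact Set.disjoint_sdiff_left
      · simp only [BTree.HasHeight, hsh, hth]
        by_cases hx : x ∈ T
        · simp only [Set.mem_sdiff, hx, hTS hx]
          have := hT.le_height x hx
          refine ⟨?_, fun h => .inr ⟨n - 1, ?_⟩⟩
          · rintro (h | ⟨m, rfl, h⟩)
            · simp at h
            · exact ⟨trivial, by omega⟩
          · simp only [true_and] at h ⊢
            omega
        · simp [hx]
      · simp only [BTree.Adj, hsh, hth, hsa, hta]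
        by_cases hx : x ∈ T <;> by_cases hy : y ∈ T
        · simp [hx, hy, hTS hx, hTS hy]
        · by_cases hyS : y ∈ S
          · have := hBT y ⟨hyS, hy⟩ x hx
            rw [P.graph.adj_comm x y, this]
            simp [hx, hy, hTS hx, hyS, add_comm]
          · simp [hx, hy, hyS]
        · by_cases hxS : x ∈ S
          · have := hBT x ⟨hxS, hx⟩ y hy
            rw [this]
            simp [hx, hy, hTS hy, hxS, add_comm]
          · simp [hx, hy, hxS]
        · simp [hx, hy]
  · push Not at hconn
    obtain ⟨A, hAS, hne, hcl, hA⟩ := hconn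
    have hBne : (S \ A).Nonempty := Set.nonempty_of_ssubset (hAS.ssubset_of_ne hA)
    have hcl' : ∀ x ∈ S \ A, ∀ y ∈ A, ¬ P.graph.Adj x y := fun x hx y hy hxy =>
      hx.2 (hcl y hy x hx.1 hxy.symm)
    have hPA : P.IsPiece k A := by
      refine ⟨hne, fun x hx => hS.le_height x (hAS hx), fun x hx hk => ?_⟩
      obtain ⟨y, hy, hxy, hh⟩ := hS.exists_below x (hAS hx) hk
      exact ⟨y, hcl x hx y hy hxy, hxy, hh⟩
    have hPB : P.IsPiece k (S \ A) := by
      refine ⟨hBne, fun x hx => hS.le_height x hx.1, fun x hx hk => ?_⟩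
      obtain ⟨y, hy, hxy, hh⟩ := hS.exists_below x hx.1 hk
      exact ⟨y, ⟨hy, fun hyA => hcl' x hx y hyA hxy⟩, hxy, hh⟩
    obtain ⟨s, hs, hsh, hsa⟩ := ih A.ncard (Set.ncard_lt_ncard
      (hAS.ssubset_of_ne hA) hfin) (hfin.subset hAS) hPA rfl
    obtain ⟨t, ht, hth, hta⟩ := ih (S \ A).ncard (Set.ncard_lt_ncard
      (Set.sdiff_ssubset_left_iff.2 (by rwa [Set.inter_eq_right.2 hAS])) hfin)
      (hfin.subset Set.sdiff_subset) hPB rfl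
    refine ⟨.union s t, ⟨hs, ht, ?_⟩, fun x n => ?_, fun x y => ?_⟩
    · rw [hsupp hPA hsh, hsupp hPB hth]
      exact Set.disjoint_sdiff_right
    · simp only [BTree.HasHeight, hsh, hth]
      by_cases hx : x ∈ A
      · simp [hx, hAS hx]
      · simp [hx]
    · simp only [BTree.Adj, hsa, hta]
      by_cases hx : x ∈ A <;> by_cases hy : y ∈ A
      · simp [hx, hy, hAS hx, hAS hy]
      · have : y ∈ S → ¬ P.graph.Adj x y := fun hyS h => hcl' y ⟨hyS, hy⟩ x hx h.symm
        simp only [hx, hy]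
        tauto
      · have : x ∈ S → ¬ P.graph.Adj x y := fun hxS h => hcl' x ⟨hxS, hx⟩ y hy h
        simp only [hx, hy]
        tauto
      · simp [hx, hy]

end Shrub

/-! ### The value of an expression in the operad of shrubs -/

namespace BTree

variable {X : Type}

theorem lab_mem_supp : ∀ (t : BTree X) (p : t.Pos), t.lab p ∈ t.supp
  | leaf _, _ => rfl
  | union a _, .inl p => .inl (a.lab_mem_supp p)
  | union _ b, .inr p => .inr (b.lab_mem_supp p)
  | graft a _, .inl p => .inl (a.lab_mem_supp p)
  | graft _ b, .inr p => .inr (b.lab_mem_supp p)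

theorem exists_lab_eq : ∀ {t : BTree X} {x : X}, x ∈ t.supp → ∃ p, t.lab p = x
  | leaf _, _, h => ⟨(), h.symm⟩
  | union _ _, _, .inl h => (exists_lab_eq h).elim fun p hp => ⟨.inl p, hp⟩
  | union _ _, _, .inr h => (exists_lab_eq h).elim fun p hp => ⟨.inr p, hp⟩
  | graft _ _, _, .inl h => (exists_lab_eq h).elim fun p hp => ⟨.inl p, hp⟩
  | graft _ _, _, .inr h => (exists_lab_eq h).elim fun p hp => ⟨.inr p, hp⟩

theorem nodup_iff_injective {t : BTree X} : t.Nodup ↔ Function.Injective t.lab := by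
  have key : ∀ a b : BTree X, (a.Nodup ↔ Function.Injective a.lab) →
      (b.Nodup ↔ Function.Injective b.lab) → (a.Nodup ∧ b.Nodup ∧ Disjoint a.supp b.supp ↔
        Function.Injective (Sum.elim a.lab b.lab)) := by
    intro a b ha hb
    rw [Sum.elim_injective, ha, hb, Set.disjoint_left]
    refine and_congr_right fun _ => and_congr_right fun _ =>
      ⟨fun h p q hpq => h (a.lab_mem_supp p) (hpq ▸ b.lab_mem_supp q), fun h x hx hx' => ?_⟩
    obtain ⟨p, rfl⟩ := exists_lab_eq hx
    obtain ⟨q, hq⟩ := exists_lab_eq hx'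
    exact h p q hq.symm
  induction t with
  | leaf x => exact iff_of_true trivial fun _ _ _ => rfl
  | union a b ha hb => exact key a b ha hb
  | graft a b ha hb => exact key a b ha hb

end BTree

namespace Arb

open BTree

variable {X : Type}

/-- `HasHeight` computes the height function of the value in `Arb`. -/
theorem eval_height {t : BTree X} (ht : t.Nodup) (p : t.Pos) (n : ℕ) :
    t.HasHeight (t.lab p) n ↔ (t.eval Arb union edge : Shrub t.Pos).height p = n := by
  induction t generalizing n with
  | leaf x => exact ⟨fun h => h.2.symm, fun h => ⟨rfl, h.symm⟩⟩
  | union a b iha ihb =>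
    have hd := Set.disjoint_left.1 ht.2.2
    rcases p with p | p
    · exact (union_hasHeight_left ht |>.trans (and_iff_left (a.lab_mem_supp p))).symm.trans
        (iha ht.1 p n)
    · refine Iff.trans ⟨fun h => ?_, fun h => .inr h⟩ (ihb ht.2.1 p n)
      exact h.resolve_left fun h => hd h.mem_supp (b.lab_mem_supp p)
  | graft a b iha ihb =>
    have hd := Set.disjoint_left.1 ht.2.2
    rcases p with p | p
    · exact (graft_hasHeight_left ht |>.trans (and_iff_left (a.lab_mem_supp p))).symm.trans
        (iha ht.1 p n)
    · cases n with
      | zero =>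
        exact iff_of_false (fun h => hd (graft_hasHeight_zero.1 h).mem_supp (b.lab_mem_supp p))
          (Nat.succ_ne_zero _)
      | succ n =>
        exact (graft_hasHeight_right ht |>.trans (and_iff_left (b.lab_mem_supp p))).symm.trans
          ((ihb ht.2.1 p n).trans Nat.succ_inj.symm)

/-- `BTree.Adj` computes the graph of the value in `Arb`. -/
theorem eval_adj {t : BTree X} (ht : t.Nodup) (p q : t.Pos) :
    t.Adj (t.lab p) (t.lab q) ↔ (t.eval Arb union edge : Shrub t.Pos).graph.Adj p q := by
  induction t with
  | leaf x => exact Iff.rfl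
  | union a b iha ihb =>
    have hd := Set.disjoint_left.1 ht.2.2
    have hcross : ∀ (p : a.Pos) (q : b.Pos), ¬ (BTree.union a b).Adj (a.lab p) (b.lab q) := by
      rintro p q (h | h)
      · exact hd h.right_mem (b.lab_mem_supp q)
      · exact hd (a.lab_mem_supp p) h.left_mem
    rcases p with p | p <;> rcases q with q | q
    · exact (union_adj_left ht |>.trans (and_iff_left (a.lab_mem_supp p))).symm.trans
        (iha ht.1 p q)
    · exact iff_of_false (hcross p q) fun h => h.1.1
    · exact iff_of_false (fun h => hcross q p h.symm) fun h => h.1.1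
    · exact ((union_adj_left (nodup_union_comm.1 ht)).trans
        ((and_iff_left (b.lab_mem_supp p)).trans or_comm)).symm.trans (ihb ht.2.1 p q)
  | graft a b iha ihb =>
    have hd := Set.disjoint_left.1 ht.2.2
    have hcross : ∀ (p : a.Pos) (q : b.Pos), (graft a b).Adj (a.lab p) (b.lab q) ↔
        (Shrub.rootedEdge.graph.Adj 1 0 ∧ (a.eval Arb union edge : Shrub a.Pos).height p = 0) ∧
          (b.eval Arb union edge : Shrub b.Pos).height q = 0 := by
      intro p q
      rw [← eval_height ht.1, ← eval_height ht.2.1]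
      refine ⟨?_, fun h => .inr (.inr (.inl ⟨h.1.2, h.2⟩))⟩
      rintro (h | h | h | h)
      · exact (hd h.right_mem (b.lab_mem_supp q)).elim
      · exact (hd (a.lab_mem_supp p) h.left_mem).elim
      · exact ⟨⟨one_ne_zero, h.1⟩, h.2⟩
      · exact (hd (a.lab_mem_supp p) h.2.mem_supp).elim
    rcases p with p | p <;> rcases q with q | q
    · exact (graft_adj_left ht |>.trans
        (and_iff_left ⟨a.lab_mem_supp p, a.lab_mem_supp q⟩)).symm.trans (iha ht.1 p q)
    · exact hcross p q
    · exact ⟨fun h => (hcross q p).1 h.symm, fun h => ((hcross q p).2 h).symm⟩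
    · exact (graft_adj_right ht |>.trans
        (and_iff_left ⟨b.lab_mem_supp p, b.lab_mem_supp q⟩)).symm.trans (ihb ht.2.1 p q)

/-- Every shrub is the value of an expression in which each label occurs exactly once. -/
theorem exists_map_eval_eq {I : Type} [Finite I] (P : Shrub I) :
    ∃ (t : BTree I) (e : t.Pos ≃ I), (∀ p, e p = t.lab p) ∧
      Arb.map e (t.eval Arb union edge) = P := by
  have hP : P.IsPiece 0 Set.univ :=
    ⟨P.nonempty.elim fun x => ⟨x, trivial⟩, fun _ _ => Nat.zero_le _, fun x _ hx => by
      obtain ⟨y, hyx, hh⟩ := P.exists_below x hx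
      exact ⟨y, trivial, hyx.symm, hh⟩⟩
  obtain ⟨t, ht, hh, ha⟩ := hP.exists_tree Set.finite_univ
  have hb : Function.Bijective t.lab :=
    ⟨nodup_iff_injective.1 ht, fun x => exists_lab_eq (mem_supp_iff.2 ⟨P.height x, by simp [hh]⟩)⟩
  let e := Equiv.ofBijective t.lab hb
  refine ⟨t, e, fun _ => rfl, ?_⟩
  have he : ∀ x, t.lab (e.symm x) = x := e.apply_symm_apply
  refine Shrub.ext (SimpleGraph.ext (funext₂ fun x y => propext ?_)) (funext fun x => ?_)
  · refine (eval_adj ht (e.symm x) (e.symm y)).symm.trans ?_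
    rw [he, he, ha]
    simp
  · refine (eval_height ht (e.symm x) (P.height x)).1 ?_
    rw [he, hh]
    simp

/-- Expressions without repeated labels that have the same shrub as value are congruent. -/
theorem cong_of_map_eval_eq {I : Type} [Finite I] {s t : BTree I} (e : s.Pos ≃ I) (f : t.Pos ≃ I)
    (he : ∀ p, e p = s.lab p) (hf : ∀ p, f p = t.lab p)
    (h : Arb.map e (s.eval Arb union edge) = Arb.map f (t.eval Arb union edge)) : s.Cong t := by
  have hs : s.Nodup := nodup_iff_injective.2 ((funext he : ⇑e = s.lab) ▸ e.injective)
  have ht : t.Nodup := nodup_iff_injective.2 ((funext hf : ⇑f = t.lab) ▸ f.injective)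
  have he' : ∀ x, s.lab (e.symm x) = x := fun x => by rw [← he, e.apply_symm_apply]
  have hf' : ∀ x, t.lab (f.symm x) = x := fun x => by rw [← hf, f.apply_symm_apply]
  refine SameShrub.cong hs ht ⟨fun x n => ?_, fun x y => ?_⟩
  · have h1 := eval_height hs (e.symm x) n
    have h2 := eval_height ht (f.symm x) n
    have h3 : (s.eval Arb union edge : Shrub _).height (e.symm x) =
      (t.eval Arb union edge : Shrub _).height (f.symm x) := congrArg (fun P => Shrub.height P x) h
    rw [he'] at h1
    rw [hf'] at h2
    rw [h1, h2, h3]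
  · have h1 := eval_adj hs (e.symm x) (e.symm y)
    have h2 := eval_adj ht (f.symm x) (f.symm y)
    have h3 : (s.eval Arb union edge : Shrub _).graph.Adj (e.symm x) (e.symm y) ↔
      (t.eval Arb union edge : Shrub _).graph.Adj (f.symm x) (f.symm y) :=
        iff_of_eq (congrArg (fun P => (Shrub.graph P).Adj x y) h)
    rw [he', he'] at h1
    rw [hf', hf'] at h2
    rw [h1, h2, h3]

end Arb

/-! ### Universal properties of free operads and of quotients -/

theorem finite_of_finite_comp {I J : Type} (i : I) [Finite ({x : I // x ≠ i} ⊕ J)] : Finite I :=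
  have : Finite {x : I // x ≠ i} := Finite.sum_left J
  Finite.of_equiv _ (unitRight i)

section lift

variable {E : Species.{u}} {O : SetOperad.{v}}

/-- The value of a formal operadic expression under an assignment `g` of the generators. -/
def FreeTerm.lift (g : ∀ (I : Type) [Finite I], E.obj I → O.obj I) :
    {I : Type} → FreeTerm E I → [Finite I] → O.obj I
  | _, .one, _ => O.one
  | _, @FreeTerm.gen _ _ _ x, _ => g _ x
  | _, @FreeTerm.map _ I _ e t, _ =>
    have : Finite I := Finite.of_equiv _ e.symm
    O.map e (t.lift g)
  | _, @FreeTerm.comp _ I J i s t, _ =>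
    have : Finite I := finite_of_finite_comp (J := J) i
    have : Finite J := Finite.sum_right {x // x ≠ i}
    O.comp i (s.lift g) (t.lift g)

variable {g : ∀ (I : Type) [Finite I], E.obj I → O.obj I}

/-- The axioms of an operad make the value of an expression well defined. Every index set that
occurs in an expression is finite because the index set of the result is. -/
theorem FreeRel.lift_eq (hg : ∀ {I J : Type} [Finite I] [Finite J] (e : I ≃ J) (x : E.obj I),
    g J (E.map e x) = O.map e (g I x))
    {I : Type} {s t : FreeTerm E I} (h : FreeRel E s t) :
    ∀ [Finite I], FreeTerm.lift g s = FreeTerm.lift g t := by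
  induction h with
  | refl s =>
    intro _
    rfl
  | symm _ ih =>
    intro _
    exact ih.symm
  | trans _ _ ih ih' =>
    intro _
    exact ih.trans ih'
  | map_congr e _ ih =>
    intro _
    have := Finite.of_equiv _ e.symm
    exact congrArg (O.map e) ih
  | @comp_congr I J i _ _ _ _ _ _ ih ih' =>
    intro _
    have := finite_of_finite_comp (J := J) i
    have := Finite.sum_right (β := J) {x // x ≠ i}
    exact congrArg₂ (O.comp i) ih ih'
  | gen_map e x =>
    intro _
    exact hg e x
  | map_refl s =>
    intro _
    exact O.map_refl _
  | map_trans e f s =>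
    intro _
    have := Finite.of_equiv _ f.symm
    have := Finite.of_equiv _ e.symm
    exact O.map_trans e f _
  | @comp_map I I' J J' e f i s t =>
    intro _
    have := finite_of_finite_comp (J := J') (e i)
    have := Finite.sum_right (β := J') {x // x ≠ e i}
    have := Finite.of_equiv _ e.symm
    have := Finite.of_equiv _ f.symm
    exact O.comp_map e f i _ _
  | one_comp t =>
    intro _
    exact O.one_comp _
  | comp_one i s =>
    intro _
    exact O.comp_one i _
  | @comp_parallel I J K i j hij p q r =>
    intro _
    have := finite_of_finite_comp (J := J) (Sum.inl ⟨i, hij⟩ : {x : I // x ≠ j} ⊕ K)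
    have := Finite.sum_right (β := J) {x : {x : I // x ≠ j} ⊕ K // x ≠ Sum.inl ⟨i, hij⟩}
    have := finite_of_finite_comp (J := K) j
    have := Finite.sum_right (β := K) {x : I // x ≠ j}
    exact O.comp_parallel hij _ _ _
  | @comp_nested I J K i j p q r =>
    intro _
    have := finite_of_finite_comp (J := {x : J // x ≠ j} ⊕ K) i
    have := Finite.sum_right (β := {x : J // x ≠ j} ⊕ K) {x : I // x ≠ i}
    have := finite_of_finite_comp (J := K) j
    have := Finite.sum_right (β := K) {x : J // x ≠ j}
    exact O.comp_nested i j _ _ _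

/-- The morphism from the free operad given by the images of the generators. -/
def FreeOperad.lift (hg : ∀ {I J : Type} [Finite I] [Finite J] (e : I ≃ J) (x : E.obj I),
    g J (E.map e x) = O.map e (g I x)) :
    (FreeOperad E).Hom O where
  app I _ := Quotient.lift (fun s : FreeTerm E I => FreeTerm.lift g s) fun _ _ h => h.lift_eq hg
  app_map := by rintro I J _ _ e ⟨s⟩; rfl
  app_one := rfl
  app_comp := by rintro I J _ _ i ⟨s⟩ ⟨t⟩; rfl

end lift

namespace SetOperad

section quotient

variable {O : SetOperad.{u}} {O' : SetOperad.{v}}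
  {R : (I : Type) → [Finite I] → O.obj I → O.obj I → Prop} (φ : O.Hom O')

theorem Cong.app_eq
    (hφ : ∀ (I : Type) [Finite I] (x y : O.obj I), R I x y → φ.app I x = φ.app I y)
    {I : Type} [Finite I] {x y : O.obj I} (h : O.Cong R I x y) :
    φ.app I x = φ.app I y := by
  induction h with
  | of h => exact hφ _ _ _ h
  | refl x => rfl
  | symm _ ih => exact ih.symm
  | trans _ _ ih ih' => exact ih.trans ih'
  | map e _ ih => rw [φ.app_map, φ.app_map, ih]
  | comp i _ _ ih ih' => rw [φ.app_comp, φ.app_comp, ih, ih']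

/-- A morphism which respects the relations factors through the quotient. -/
def quotientLift
    (hφ : ∀ (I : Type) [Finite I] (x y : O.obj I), R I x y → φ.app I x = φ.app I y) :
    (O.quotient R).Hom O' where
  app I _ := Quotient.lift (φ.app I) fun _ _ h => Cong.app_eq φ hφ h
  app_map := by rintro I J _ _ e ⟨s⟩; exact φ.app_map e s
  app_one := φ.app_one
  app_comp := by rintro I J _ _ i ⟨s⟩ ⟨t⟩; exact φ.app_comp i s t

end quotient

/-! ### Morphisms and the elements generated by two binary operations -/

section hom

variable {O : SetOperad.{u}} {O' : SetOperad.{v}} (φ : O.Hom O')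

theorem Hom.app_bin {J K : Type} [Finite J] [Finite K] (p : O.obj (Fin 2)) (s : O.obj J)
    (t : O.obj K) : φ.app _ (O.bin p s t) = O'.bin (φ.app _ p) (φ.app _ s) (φ.app _ t) := by
  rw [bin, φ.app_map, φ.app_comp, φ.app_comp, bin]

theorem Hom.app_leftComp (p q : O.obj (Fin 2)) (x y z : Fin 3) (h) :
    φ.app _ (O.leftComp p q x y z h) = O'.leftComp (φ.app _ p) (φ.app _ q) x y z h := by
  rw [leftComp, φ.app_map, φ.app_comp, leftComp]

theorem Hom.app_rightComp (p q : O.obj (Fin 2)) (x y z : Fin 3) (h) :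
    φ.app _ (O.rightComp p q x y z h) = O'.rightComp (φ.app _ p) (φ.app _ q) x y z h := by
  rw [rightComp, φ.app_map, φ.app_comp, rightComp]

theorem Hom.app_eval {X : Type} (c d : O.obj (Fin 2)) (t : BTree X) :
    φ.app _ (t.eval O c d) = t.eval O' (φ.app _ c) (φ.app _ d) := by
  induction t with
  | leaf x => exact φ.app_one
  | union a b iha ihb =>
    exact (φ.app_bin _ _ _).trans (congrArg₂ (O'.bin _) iha ihb)
  | graft a b iha ihb =>
    exact (φ.app_bin _ _ _).trans (congrArg₂ (O'.bin _) iha ihb)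

theorem Rep.app_eq {φ ψ : O.Hom O'} {c d : O.obj (Fin 2)} (hc : φ.app _ c = ψ.app _ c)
    (hd : φ.app _ d = ψ.app _ d) {I : Type} [Finite I] {x : O.obj I} (hx : O.Rep c d I x) :
    φ.app I x = ψ.app I x := by
  induction hx with
  | one => rw [φ.app_one, ψ.app_one]
  | map e _ ih => rw [φ.app_map, ψ.app_map, ih]
  | left _ _ ih ih' => rw [φ.app_bin, ψ.app_bin, hc, ih, ih']
  | right _ _ ih ih' => rw [φ.app_bin, ψ.app_bin, hd, ih, ih']

theorem IsSuboperad.mem_of_rep {S : (I : Type) → [Finite I] → Set (O.obj I)}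
    (hS : O.IsSuboperad S) {c d : O.obj (Fin 2)} (hc : c ∈ S (Fin 2)) (hd : d ∈ S (Fin 2))
    {I : Type} [Finite I] {x : O.obj I} (hx : O.Rep c d I x) : x ∈ S I := by
  induction hx with
  | one => exact hS.one_mem
  | map e _ ih => exact hS.map_mem e _ ih
  | left _ _ ih ih' =>
    exact hS.map_mem _ _ (hS.comp_mem _ _ _ (hS.comp_mem _ _ _ hc ih) ih')
  | right _ _ ih ih' =>
    exact hS.map_mem _ _ (hS.comp_mem _ _ _ (hS.comp_mem _ _ _ hd ih) ih')

theorem rep_left (c d : O.obj (Fin 2)) : O.Rep c d (Fin 2) c := by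
  obtain ⟨e, he⟩ := O.exists_eq_map_bin_one c
  have := Rep.map e (Rep.left (c := c) (d := d) .one .one)
  rwa [he] at this

theorem rep_right (c d : O.obj (Fin 2)) : O.Rep c d (Fin 2) d := by
  obtain ⟨e, he⟩ := O.exists_eq_map_bin_one d
  have := Rep.map e (Rep.right (c := c) (d := d) .one .one)
  rwa [he] at this

end hom

/-! ### Quadratic relations -/

section relations

variable {O : SetOperad.{u}}

theorem comp_eq_of_leftComp_eq_rightComp {p q p' q' : O.obj (Fin 2)} {x y z : Fin 3} {h h'}
    (H : O.leftComp p q x y z h = O.rightComp p' q' x y z h') :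
    O.comp 0 p q = O.map cycleEquiv (O.comp 1 p' q') := by
  refine O.map_injective (Equiv.ofBijective _ h) (H.trans ?_)
  rw [map_map]
  refine congrArg (fun e => O.map e _) ?_
  ext (k | k)
  · rfl
  · fin_cases k <;> rfl

theorem rightComp_eq_leftComp {p q : O.obj (Fin 2)} (hp : O.map (Equiv.swap 0 1) p = p)
    {x y z : Fin 3} {h h'} : O.rightComp p q x y z h = O.leftComp p q y z x h' := by
  have := O.comp_map_left (Equiv.swap (0 : Fin 2) 1) (Equiv.swap_apply_left 0 1) p q
  rw [hp] at this
  rw [rightComp, leftComp, this, map_map]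
  refine congrArg (fun e => O.map e _) ?_
  ext (k | k) <;> rfl

end relations

end SetOperad

namespace Shrub

/-! ### The relations hold for shrubs -/

/-- The rooted tree with root `r` in which all other vertices are children of the root. -/
noncomputable def corolla {I : Type} (r : I) : Shrub I where
  nonempty := ⟨r⟩
  graph :=
    { Adj := fun x y => (x = r ∧ y ≠ r) ∨ (x ≠ r ∧ y = r)
      symm := ⟨fun x y h => by tauto⟩
      loopless := ⟨fun x h => by tauto⟩ }
  height := open Classical in fun x => if x = r then 0 else 1
  height_adj := by
    rintro i j (⟨rfl, h⟩ | ⟨h, rfl⟩) <;> simp [h]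
  exists_below j h := ⟨r, by by_cases hj : j = r <;> simp_all⟩
  no_five := by
    intro a b c d e h1 h2 h3 h4 h
    by_cases hc : c = r <;> simp_all
  no_four := by
    intro a b c d h1
    exfalso
    split_ifs at h1 <;> omega

theorem map_corolla {I J : Type} (e : I ≃ J) (r : I) : (corolla r).map e = corolla (e r) := by
  classical
  ext x y
  · simp [map, corolla, Equiv.symm_apply_eq]
  · exact if_congr (Equiv.symm_apply_eq e) rfl rfl

theorem corolla_zero : corolla (0 : Fin 2) = rootedEdge := by
  ext x y
  · fin_cases x <;> fin_cases y <;> simp [corolla, rootedEdge]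
  · fin_cases x <;> simp [corolla, rootedEdge]

theorem map_eq_of_forall {I J : Type} (e : I ≃ J) {P : Shrub I} {Q : Shrub J}
    (ha : ∀ x y, P.graph.Adj x y ↔ Q.graph.Adj (e x) (e y))
    (hh : ∀ x, P.height x = Q.height (e x)) : P.map e = Q := by
  ext x y
  · simpa [map] using ha (e.symm x) (e.symm y)
  · simpa [map] using hh (e.symm x)

end Shrub

namespace Arb

theorem leftComp_edge_edge (x y z : Fin 3) (h) :
    Arb.leftComp edge edge x y z h = Shrub.corolla x := by
  have hz : z ≠ x := fun e => Sum.inl_ne_inr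
    (h.1 (a₁ := Sum.inl ⟨1, one_ne_zero⟩) (a₂ := Sum.inr 0) e)
  have hy : y ≠ x := fun e => one_ne_zero (Sum.inr_injective
    (h.1 (a₁ := Sum.inr 1) (a₂ := Sum.inr 0) e))
  refine Shrub.map_eq_of_forall _ ?_ ?_
  · rintro (⟨i, hi⟩ | i) (⟨j, hj⟩ | j)
    · obtain rfl : i = 1 := by omega
      obtain rfl : j = 1 := by omega
      simp [Arb, Shrub.comp, edge, Shrub.corolla]
    · obtain rfl : i = 1 := by omega
      fin_cases j <;>
        simp [Arb, Shrub.comp, Shrub.compAdj, edge, Shrub.corolla, Shrub.rootedEdge, hz, hy]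
    · obtain rfl : j = 1 := by omega
      fin_cases i <;>
        simp [Arb, Shrub.comp, Shrub.compAdj, edge, Shrub.corolla, Shrub.rootedEdge, hz, hy]
    · fin_cases i <;> fin_cases j <;>
        simp [Arb, Shrub.comp, Shrub.compAdj, edge, Shrub.corolla, Shrub.rootedEdge, hy]
  · rintro (⟨i, hi⟩ | i)
    · obtain rfl : i = 1 := by omega
      simp [Arb, Shrub.comp, Shrub.compHeight, edge, Shrub.corolla, Shrub.rootedEdge, hz]
    · fin_cases i <;>
        simp [Arb, Shrub.comp, Shrub.compHeight, edge, Shrub.corolla, Shrub.rootedEdge, hy]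

theorem rightComp_edge_union (x y z : Fin 3) (h) :
    Arb.rightComp edge union x y z h = Shrub.corolla x := by
  have hy : y ≠ x := fun e => Sum.inr_ne_inl
    (h.1 (a₁ := Sum.inr 0) (a₂ := Sum.inl ⟨0, zero_ne_one⟩) e)
  have hz : z ≠ x := fun e => Sum.inr_ne_inl
    (h.1 (a₁ := Sum.inr 1) (a₂ := Sum.inl ⟨0, zero_ne_one⟩) e)
  refine Shrub.map_eq_of_forall _ ?_ ?_
  · rintro (⟨i, hi⟩ | i) (⟨j, hj⟩ | j)
    · obtain rfl : i = 0 := by omega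
      obtain rfl : j = 0 := by omega
      simp [Arb, Shrub.comp, edge, Shrub.corolla]
    · obtain rfl : i = 0 := by omega
      fin_cases j <;>
        simp [Arb, Shrub.comp, Shrub.compAdj, edge, union, Shrub.points, Shrub.corolla,
          Shrub.rootedEdge, hz, hy]
    · obtain rfl : j = 0 := by omega
      fin_cases i <;>
        simp [Arb, Shrub.comp, Shrub.compAdj, edge, union, Shrub.points, Shrub.corolla,
          Shrub.rootedEdge, hz, hy]
    · fin_cases i <;> fin_cases j <;>
        simp [Arb, Shrub.comp, Shrub.compAdj, union, Shrub.points, Shrub.corolla, hz, hy]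
  · rintro (⟨i, hi⟩ | i)
    · obtain rfl : i = 0 := by omega
      simp [Arb, Shrub.comp, Shrub.compHeight, edge, Shrub.corolla, Shrub.rootedEdge]
    · fin_cases i <;>
        simp [Arb, Shrub.comp, Shrub.compHeight, edge, union, Shrub.points, Shrub.corolla,
          Shrub.rootedEdge, hz, hy]

theorem leftComp_union_union (x y z : Fin 3) (h) :
    Arb.leftComp union union x y z h = Shrub.points (Fin 3) := by
  refine Shrub.map_eq_of_forall _ ?_ ?_
  · rintro (i | i) (j | j) <;>
      simp [Arb, Shrub.comp, Shrub.compAdj, union, Shrub.points]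
  · rintro (i | i) <;>
      simp [Arb, Shrub.comp, Shrub.compHeight, union, Shrub.points]

end Arb

/-! ### The presentation of the operad of shrubs -/

/-- The images of the generators: `C` is sent to the shrub without edges and `D` to the rooted
tree with one edge. -/
noncomputable def arbOfGen (I : Type) [Finite I] : ArbGen I → Arb.obj I
  | .C h => @Shrub.points I (Nat.card_pos_iff.1 (by omega : 0 < Nat.card I)).1
  | .D _ r => Shrub.corolla r

theorem arbOfGen_map {I J : Type} [Finite I] [Finite J] (e : I ≃ J) (x : arbGen.obj I) :
    arbOfGen J (arbGen.map e x) = Arb.map e (arbOfGen I x) := by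
  rcases x with h | ⟨h, r⟩
  · rfl
  · exact (Shrub.map_corolla e r).symm

/-- The morphism from the free operad to the operad of shrubs. -/
noncomputable def freeToArb : (FreeOperad arbGen).Hom Arb :=
  FreeOperad.lift (g := arbOfGen) arbOfGen_map

theorem freeToArb_genC : freeToArb.app (Fin 2) genC = Arb.union := rfl

theorem freeToArb_genD : freeToArb.app (Fin 2) genD = Arb.edge := Shrub.corolla_zero

theorem freeToArb_eq_of_arbRel (I : Type) [Finite I] (x y : (FreeOperad arbGen).obj I)
    (h : ArbRel I x y) : freeToArb.app I x = freeToArb.app I y := by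
  cases h <;> simp only [SetOperad.Hom.app_leftComp, SetOperad.Hom.app_rightComp, freeToArb_genC,
    freeToArb_genD, Arb.leftComp_edge_edge, Arb.rightComp_edge_union,
    Arb.leftComp_union_union] <;>
  rfl

namespace PresentedArb

/-- The morphism from the presented operad to the operad of shrubs. -/
noncomputable def toArb : PresentedArb.Hom Arb :=
  SetOperad.quotientLift freeToArb freeToArb_eq_of_arbRel

theorem toArb_C : toArb.app (Fin 2) C = Arb.union := freeToArb_genC

theorem toArb_D : toArb.app (Fin 2) D = Arb.edge := freeToArb_genD

/-- The generator `C` is symmetric. -/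
theorem swap_C : PresentedArb.map (Equiv.swap 0 1) C = C :=
  congrArg ((FreeOperad arbGen).toQuotient ArbRel)
    (Quotient.sound (FreeRel.symm (FreeRel.gen_map (E := arbGen) (Equiv.swap 0 1) (ArbGen.C _))))

/-- The relations of the presented operad, in the form in which `BTree.Cong` uses them. -/
theorem isAction : PresentedArb.IsAction C D where
  swap := swap_C
  assoc := by
    -- `C(C(1, 2), 0) = C(C(2, 0), 1) = C(1, C(2, 0))`, the last step by symmetry of `C`
    have h : PresentedArb.leftComp C C 1 2 0 = PresentedArb.leftComp C C 2 0 1 :=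
      Quotient.sound (.of .comm)
    exact SetOperad.comp_eq_of_leftComp_eq_rightComp (x := 1) (y := 2) (z := 0) (h' := by decide)
      (h.trans (SetOperad.rightComp_eq_leftComp swap_C).symm)
  act := by
    have h : PresentedArb.leftComp D D 2 0 1 = PresentedArb.rightComp D C 2 0 1 :=
      Quotient.sound (.of .nap_right)
    exact SetOperad.comp_eq_of_leftComp_eq_rightComp h

theorem rep_gen {I : Type} [Finite I] (x : ArbGen I) : PresentedArb.Rep C D I
    ((FreeOperad arbGen).toQuotient ArbRel (FreeOperad.gen (E := arbGen) x)) := by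
  have hmap : ∀ (e : Fin 2 ≃ I) (y : ArbGen (Fin 2)),
      (FreeOperad arbGen).toQuotient ArbRel (FreeOperad.gen (E := arbGen) (arbGen.map e y)) =
        PresentedArb.map e
          ((FreeOperad arbGen).toQuotient ArbRel (FreeOperad.gen (E := arbGen) y)) :=
    fun e y => congrArg ((FreeOperad arbGen).toQuotient ArbRel)
      (Quotient.sound (FreeRel.gen_map (E := arbGen) e y))
  rcases x with h | ⟨h, r⟩
  · let e := (Finite.equivFinOfCardEq h).symm
    have := SetOperad.Rep.map e (SetOperad.rep_left C D)
    rwa [C, genC, ← hmap] at this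
  · let e₀ := (Finite.equivFinOfCardEq h).symm
    -- a bijection that sends the root `0` of `D` to `r`
    obtain ⟨e, he⟩ : ∃ e : Fin 2 ≃ I, e 0 = r :=
      ⟨(Equiv.swap 0 (e₀.symm r)).trans e₀, by simp⟩
    have := SetOperad.Rep.map e (SetOperad.rep_right C D)
    rw [D, genD, ← hmap] at this
    subst he
    exact this

/-- The presented operad is generated by `C` and `D`. -/
theorem rep {I : Type} [Finite I] (x : PresentedArb.obj I) : PresentedArb.Rep C D I x := by
  have key : ∀ {I : Type} (t : FreeTerm arbGen I) [Finite I], PresentedArb.Rep C D I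
      ((FreeOperad arbGen).toQuotient ArbRel (Quotient.mk (freeSetoid arbGen I) t)) := by
    intro I t
    induction t with
    | one => intro _; exact .one
    | gen x => intro _; exact rep_gen x
    | map e t ih =>
      intro _
      have := Finite.of_equiv _ e.symm
      exact .map e ih
    | @comp I J i s t ih ih' =>
      intro _
      have := finite_of_finite_comp (J := J) i
      have := Finite.sum_right (β := J) {x // x ≠ i}
      exact ih.comp ih' i
  obtain ⟨⟨t⟩⟩ := x
  exact key t

/-- Two elements of the presented operad with the same shrub are values of expressions that are
congruent, hence they are equal. -/
theorem toArb_injective (I : Type) [Finite I] : Function.Injective (toArb.app I) := by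
  intro x y h
  obtain ⟨s, e, he, rfl⟩ := (rep x).exists_tree
  obtain ⟨t, f, hf, rfl⟩ := (rep y).exists_tree
  rw [toArb.app_map, toArb.app_map, toArb.app_eval, toArb.app_eval, toArb_C, toArb_D] at h
  obtain ⟨g, hg, hv⟩ := (Arb.cong_of_map_eval_eq e f he hf h).exists_equiv isAction
  rw [← hv, SetOperad.map_map]
  refine congrArg (fun e => PresentedArb.map e _) (Equiv.ext fun p => ?_)
  rw [Equiv.trans_apply, he, hf, hg]

theorem toArb_surjective (I : Type) [Finite I] : Function.Surjective (toArb.app I) := by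
  intro P
  obtain ⟨t, e, -, rfl⟩ := Arb.exists_map_eval_eq P
  exact ⟨PresentedArb.map e (t.eval PresentedArb C D), by
    rw [toArb.app_map, toArb.app_eval, toArb_C, toArb_D]⟩

theorem toArb_isIso : toArb.IsIso := fun I _ => ⟨toArb_injective I, toArb_surjective I⟩

end PresentedArb

theorem Arb.rep {I : Type} [Finite I] (P : Arb.obj I) : Arb.Rep Arb.union Arb.edge I P := by
  obtain ⟨t, e, -, rfl⟩ := Arb.exists_map_eval_eq P
  exact .map e (t.rep_eval _ _ _)

theorem mainTheorem1 :
    -- `Arb` is generated by `[0][1]` and `[0 ◁ 1]`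
    (∀ S : (I : Type) → [Finite I] → Set (Arb.obj I), Arb.IsSuboperad S →
      Arb.union ∈ S (Fin 2) → Arb.edge ∈ S (Fin 2) →
      ∀ (I : Type) [Finite I] (P : Arb.obj I), P ∈ S I) ∧
    -- these elements satisfy the relations
    Arb.leftComp Arb.edge Arb.edge 2 1 0 = Arb.leftComp Arb.edge Arb.edge 2 0 1 ∧
    Arb.leftComp Arb.edge Arb.edge 2 0 1 = Arb.rightComp Arb.edge Arb.union 2 0 1 ∧
    Arb.leftComp Arb.union Arb.union 1 2 0 = Arb.leftComp Arb.union Arb.union 2 0 1 ∧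
    -- and no other relation is needed: the presented operad is isomorphic to `Arb`
    (∃ φ : PresentedArb.Hom Arb,
      (φ.app (Fin 2) PresentedArb.C = Arb.union ∧ φ.app (Fin 2) PresentedArb.D = Arb.edge) ∧
      φ.IsIso ∧
      ∀ ψ : PresentedArb.Hom Arb,
        ψ.app (Fin 2) PresentedArb.C = Arb.union → ψ.app (Fin 2) PresentedArb.D = Arb.edge →
        ψ = φ) ∧
    Arb.IsBinaryQuadratic := by
  refine ⟨fun S hS hu he I _ P => hS.mem_of_rep hu he (Arb.rep P), ?_, ?_, ?_,
    ⟨PresentedArb.toArb, ⟨PresentedArb.toArb_C, PresentedArb.toArb_D⟩,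
      PresentedArb.toArb_isIso, fun ψ hC hD => ?_⟩,
    arbGen, ArbRel, PresentedArb.toArb, fun I _ ⟨x⟩ => ?_, fun I _ x y h => ?_,
    PresentedArb.toArb_isIso⟩
  · rw [Arb.leftComp_edge_edge, Arb.leftComp_edge_edge]
  · rw [Arb.leftComp_edge_edge, Arb.rightComp_edge_union]
  · rw [Arb.leftComp_union_union, Arb.leftComp_union_union]
  · ext I _ x
    exact (PresentedArb.rep x).app_eq (hC.trans PresentedArb.toArb_C.symm)
      (hD.trans PresentedArb.toArb_D.symm)
  · cases x <;> assumption
  · cases h <;> simp
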